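/- Let $n\ge 0$ be an integer and let $\mathcal P(n)$ be the set of real symmetric positive definite $n\times n$ matrices of determinant $1$, on which $g\in SL(n,\mathbb R)$ acts by $g.X=g^{T}Xg$. For a nonzero symmetric matrix $A$ put $A^\perp=\{X\in\mathcal P(n):\operatorname{tr}(XA)=0\}$. A co-oriented hyperplane is a nonempty $A^\perp$ together with its normal vector $A$, where normal vectors that differ by a positive multiple give the same co-oriented hyperplane; $-\sigma$ denotes the co-oriented hyperplane with normal vector $-A$ if $\sigma=A^\perp$, and $g.A^\perp=(g^{-1}Ag^{-T})^\perp$. A co-oriented hyperplane lies between $A^\perp$ and $B^\perp$ if its normal vector is $pA+qB$ with $p,q>0$. An invariant angle function is a real-valued function $\theta$ on a set $D$ (its domain) of ordered pairs of co-oriented hyperplanes of $\mathcal P(n)$, such that for all $(\sigma_1,\sigma_2)\in D$ and $g\in SL(n,\mathbb R)$ the pairs $(g.\sigma_1,g.\sigma_2)$, $(\sigma_2,\sigma_1)$, $(-\sigma_1,\sigma_2)$ are in $D$, such that $(\sigma_1,\sigma_2),(\sigma_2,\sigma_3)\in D$ whenever $(\sigma_1,\sigma_3)\in D$ and $\sigma_2$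 lies between $\sigma_1$ and $\sigma_3$, and such that, for all these pairs: * $0\le\theta(\sigma_1,\sigma_2)\le\pi$, with $\theta(\sigma_1,\sigma_2)=0$ iff $\sigma_1=\sigma_2$, and $\theta(\sigma_1,\sigma_2)=\pi$ iff $\sigma_1=-\sigma_2$; * $\theta(g.\sigma_1,g.\sigma_2)=\theta(\sigma_1,\sigma_2)$; * $\theta(\sigma_2,\sigma_1)=\theta(\sigma_1,\sigma_2)$ and $\theta(-\sigma_1,\sigma_2)=\pi-\theta(\sigma_1,\sigma_2)$; * $\theta(\sigma_1,\sigma_2)+\theta(\sigma_2,\sigma_3)=\theta(\sigma_1,\sigma_3)$ if $\sigma_2$ lies between $\sigma_1$ and $\sigma_3$. The pencil $(A,B)$ is regular if $\det(A-\lambda B)\ne0$ for some $\lambda\in\mathbb C$. Its generalized eigenvalues are the $\lambda\in\mathbb C$ with $\det(A-\lambda B)=0$, together with $\infty$ if $\det B=0$. **Theorem.** 1. The following is an invariant angle function whose domain is the set of all pairs $(A^\perp,B^\perp)$ such that $(A,B)$ is regular and has a nonreal (finite) generalized eigenvalue: if $\lambda_1,\dots,\lambda_k,\overline{\lambda_1},\dots,\overline{\lambda_k}$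 are the distinct nonreal generalized eigenvalues of $(A,B)$, listed once each, then $$\theta(A^\perp,B^\perp)=\frac1k\sum_{i=1}^k|\arg\lambda_i|,\qquad \arg\in(-\pi,\pi].$$ 2. For $k\ge3$ and real $\lambda_1<\dots<\lambda_k$, with $\lambda_{k+1}=\lambda_1$, put $$R=\Bigl(\sum_{i=1}^k\frac{1}{\lambda_{i+1}-\lambda_i}\Bigr)\Bigl(\sum_{i=1}^k\frac{(\lambda_{i+1}+\lambda_i)^2}{\lambda_{i+1}-\lambda_i}\Bigr),\qquad t(\lambda_1,\dots,\lambda_k)=\frac{1}{\sqrt R}\sum_{i=1}^k\frac{\lambda_{i+1}+\lambda_i}{\lambda_{i+1}-\lambda_i}.$$ Then $R>0$ and $|t|\le1$. The following is an invariant angle function whose domain is the set of all pairs $(A^\perp,B^\perp)$ such that $(A,B)$ is regular and has at least three distinct generalized eigenvalues, all of them real or $\infty$: if the distinct generalized eigenvalues are the real numbers $\lambda_1<\dots<\lambda_k$, then $\theta(A^\perp,B^\perp)=\arccos t(\lambda_1,\dots,\lambda_k)$; if they are the real numbers $\lambda_1<\dots<\lambda_{k-1}$ and $\infty$, then $\theta(A^\perp,B^\perp)=\lim_{\lambda_k\to+\infty}\arccos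 t(\lambda_1,\dots,\lambda_k)$. 3. If $A^\perp$, $B^\perp$ are co-oriented hyperplanes with $A^\perp\ne\pm B^\perp$ (as co-oriented hyperplanes), and $(A,B)$ is regular and has at most two distinct generalized eigenvalues, all of them real or $\infty$, then $(A^\perp,B^\perp)$ is not in the domain of any invariant angle function. -/

import Mathlib

open Matrix

namespace SelbergSpace

/-- Real `n × n` matrices. -/
abbrev Mat (n : ℕ) : Type := Matrix (Fin n) (Fin n) ℝ

/-- The group `SL(n,ℝ)`. -/
abbrev SL (n : ℕ) : Type := Matrix.SpecialLinearGroup (Fin n) ℝ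

/-- The symmetric space `P(n) = SL(n,ℝ)/SO(n)` in the symmetric matrices model: positive definite
(in particular symmetric) real matrices of determinant one. -/
def PSpace (n : ℕ) : Set (Mat n) := {X | X.PosDef ∧ X.det = 1}

/-- The action of `g ∈ SL(n,ℝ)` on `P(n)` by the congruence transformation `g.X = gᵀ X g`. -/
def actPoint {n : ℕ} (g : SL n) (X : Mat n) :
    Mat n := (↑g : Mat n)ᵀ * X * (↑g : Mat n)

/-- The normal space `A^⊥ = {X ∈ P(n) | tr (X A) = 0}`. -/
def normalSpace {n : ℕ} (A : Mat n) : Set (Mat n) :=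
  {X | X ∈ PSpace n ∧ (X * A).trace = 0}

/-- A normal vector of a hyperplane: a nonzero symmetric matrix `A` with `A^⊥` nonempty. -/
structure NormalVector (n : ℕ) where
  mat : Mat n
  symm : mat.IsSymm
  ne_zero : mat ≠ 0
  nonempty : (normalSpace mat).Nonempty

/-- Two normal vectors define the same co-oriented hyperplane when they differ by a positive
multiple. -/
instance normalVectorSetoid (n : ℕ) : Setoid (NormalVector n) where
  r A B := ∃ c : ℝ, 0 < c ∧ B.mat = c • A.mat
  iseqv :=
    { refl := fun A => ⟨1, one_pos, (one_smul ℝ A.mat).symm⟩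
      symm := by
        rintro A B ⟨c, hc, h⟩
        exact ⟨c⁻¹, inv_pos.mpr hc, by rw [h, smul_smul, inv_mul_cancel₀ hc.ne', one_smul]⟩
      trans := by
        rintro A B C ⟨c, hc, h⟩ ⟨d, hd, h'⟩
        exact ⟨d * c, mul_pos hd hc, by rw [h', h, smul_smul]⟩ }

/-- Co-oriented hyperplanes of `P(n)`: normal vectors up to positive multiples. -/
def CoHyperplane (n : ℕ) : Type := Quotient (normalVectorSetoid n)

/-- The co-oriented hyperplane `A^⊥` with normal vector `A`. -/
def NormalVector.perp {n : ℕ} (A : NormalVector n) : CoHyperplane n :=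
  Quotient.mk (normalVectorSetoid n) A

/-- The opposite normal vector. -/
def NormalVector.neg {n : ℕ} (A : NormalVector n) : NormalVector n where
  mat := -A.mat
  symm := A.symm.neg
  ne_zero := neg_ne_zero.mpr A.ne_zero
  nonempty := by
    obtain ⟨X, hX, h⟩ := A.nonempty
    exact ⟨X, hX, by rw [mul_neg, trace_neg, h, neg_zero]⟩

theorem actPoint_mem {n : ℕ} (g : SL n) {X : Mat n}
    (hX : X ∈ PSpace n) : actPoint g X ∈ PSpace n := by
  refine ⟨?_, ?_⟩
  · have hu : IsUnit (↑g : Mat n) := by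
      rw [Matrix.isUnit_iff_isUnit_det, Matrix.SpecialLinearGroup.det_coe]; exact isUnit_one
    have := hX.1.conjTranspose_mul_mul_same (B := (↑g : Mat n)) (Matrix.mulVec_injective_iff_isUnit.mpr hu)
    rwa [conjTranspose_eq_transpose_of_trivial] at this
  · simp [actPoint, det_mul, hX.2]

/-- Trace pairing with the transformed normal vector. -/
theorem trace_actPoint {n : ℕ} (g : SL n)
    (X A : Mat n) :
    (actPoint g X * ((↑g⁻¹ : Mat n) * A * (↑g⁻¹ : Mat n)ᵀ)).trace = (X * A).trace := by
  have h1 : (↑g : Mat n) * (↑g⁻¹ : Mat n) = 1 := by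
    rw [← Matrix.SpecialLinearGroup.coe_mul, mul_inv_cancel, Matrix.SpecialLinearGroup.coe_one]
  have h2 : (↑g⁻¹ : Mat n)ᵀ * (↑g : Mat n)ᵀ = 1 := by rw [← transpose_mul, h1, transpose_one]
  have e : actPoint g X * ((↑g⁻¹ : Mat n) * A * (↑g⁻¹ : Mat n)ᵀ)
      = (↑g : Mat n)ᵀ * (X * ((↑g : Mat n) * (↑g⁻¹ : Mat n)) * A * (↑g⁻¹ : Mat n)ᵀ) := by
    simp only [actPoint, Matrix.mul_assoc]
  rw [e, h1, trace_mul_comm, Matrix.mul_assoc, h2, Matrix.mul_one, Matrix.mul_one]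

/-- The normal vector `g⁻¹ A g⁻ᵀ` of the image under `g` of the co-oriented hyperplane `A^⊥`
(see `trace_actPoint` and `normalSpace_act`). -/
def NormalVector.act {n : ℕ} (g : SL n) (A : NormalVector n) :
    NormalVector n where
  mat := (↑g⁻¹ : Mat n) * A.mat * (↑g⁻¹ : Mat n)ᵀ
  symm := by
    unfold Matrix.IsSymm
    rw [transpose_mul, transpose_mul, transpose_transpose, A.symm.eq, Matrix.mul_assoc]
  ne_zero := by
    intro h
    have h1 : (↑g : Mat n) * (↑g⁻¹ : Mat n) = 1 := by
      rw [← Matrix.SpecialLinearGroup.coe_mul, mul_inv_cancel, Matrix.SpecialLinearGroup.coe_one]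
    have h2 : (↑g⁻¹ : Mat n)ᵀ * (↑g : Mat n)ᵀ = 1 := by rw [← transpose_mul, h1, transpose_one]
    apply A.ne_zero
    calc A.mat = ((↑g : Mat n) * (↑g⁻¹ : Mat n)) * A.mat * ((↑g⁻¹ : Mat n)ᵀ * (↑g : Mat n)ᵀ) := by
          rw [h1, h2, Matrix.one_mul, Matrix.mul_one]
      _ = (↑g : Mat n) * ((↑g⁻¹ : Mat n) * A.mat * (↑g⁻¹ : Mat n)ᵀ) * (↑g : Mat n)ᵀ := by simp only [Matrix.mul_assoc]
      _ = 0 := by rw [h, Matrix.mul_zero, Matrix.zero_mul]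
  nonempty := by
    obtain ⟨X, hX, h⟩ := A.nonempty
    exact ⟨actPoint g X, actPoint_mem g hX, by rw [trace_actPoint, h]⟩

/-- The normal space of the transformed normal vector is the image of the normal space. -/
theorem normalSpace_act {n : ℕ} (g : SL n) (A : NormalVector n) :
    normalSpace (A.act g).mat = actPoint g '' normalSpace A.mat := by
  have h1 : (↑g⁻¹ : Mat n) * (↑g : Mat n) = 1 := by
    rw [← Matrix.SpecialLinearGroup.coe_mul, inv_mul_cancel, Matrix.SpecialLinearGroup.coe_one]
  have h2 : (↑g : Mat n)ᵀ * (↑g⁻¹ : Mat n)ᵀ = 1 := by rw [← transpose_mul, h1, transpose_one]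
  have key : ∀ Y, actPoint g (actPoint g⁻¹ Y) = Y := by
    intro Y
    calc actPoint g (actPoint g⁻¹ Y)
        = ((↑g : Mat n)ᵀ * (↑g⁻¹ : Mat n)ᵀ) * Y * ((↑g⁻¹ : Mat n) * (↑g : Mat n)) := by
          simp only [actPoint, Matrix.mul_assoc]
      _ = Y := by rw [h1, h2, Matrix.one_mul, Matrix.mul_one]
  ext Y
  constructor
  · rintro ⟨hY, h⟩
    refine ⟨actPoint g⁻¹ Y, ⟨actPoint_mem g⁻¹ hY, ?_⟩, key Y⟩
    rw [← trace_actPoint g, key Y]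
    exact h
  · rintro ⟨X, ⟨hX, h⟩, rfl⟩
    exact ⟨actPoint_mem g hX, (trace_actPoint g X A.mat).trans h⟩

/-- The oppositely co-oriented hyperplane `-σ`. -/
def CoHyperplane.neg {n : ℕ} (σ : CoHyperplane n) : CoHyperplane n :=
  Quotient.map' NormalVector.neg
    (by
      rintro A B ⟨c, hc, h⟩
      exact ⟨c, hc, by simp [NormalVector.neg, h]⟩) σ

/-- The image `g.σ` of a co-oriented hyperplane under `g ∈ SL(n,ℝ)`. -/
def CoHyperplane.act {n : ℕ} (g : SL n) (σ : CoHyperplane n) :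
    CoHyperplane n :=
  Quotient.map' (NormalVector.act g)
    (by
      rintro A B ⟨c, hc, h⟩
      exact ⟨c, hc, by simp [NormalVector.act, h]⟩) σ

/-- `σ₂` lies between `σ₁` and `σ₃`: its normal vector is a positive linear combination of normal
vectors of `σ₁` and `σ₃`. -/
def LiesBetween {n : ℕ} (σ₂ σ₁ σ₃ : CoHyperplane n) : Prop :=
  ∃ A₁ A₂ A₃ : NormalVector n, A₁.perp = σ₁ ∧ A₂.perp = σ₂ ∧ A₃.perp = σ₃ ∧
    ∃ p q : ℝ, 0 < p ∧ 0 < q ∧ A₂.mat = p • A₁.mat + q • A₃.mat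

/-- `θ` is an invariant angle function with domain `D`. An invariant angle function is a partial
function on pairs of co-oriented hyperplanes; the values of `θ` outside `D` play no role. The four
`mem` clauses say that the angles occurring in the properties of an invariant angle function are
defined: the domain is stable under `SL(n,ℝ)`, under exchanging the two hyperplanes, under
reversing a co-orientation, and under subdivision by a hyperplane lying between. -/
structure IsInvariantAngleFunction {n : ℕ} (D : Set (CoHyperplane n × CoHyperplane n))
    (θ : CoHyperplane n → CoHyperplane n → ℝ) : Prop where
  act_mem : ∀ σ₁ σ₂, (σ₁, σ₂) ∈ D → ∀ g, (σ₁.act g, σ₂.act g) ∈ D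
  swap_mem : ∀ σ₁ σ₂, (σ₁, σ₂) ∈ D → (σ₂, σ₁) ∈ D
  neg_mem : ∀ σ₁ σ₂, (σ₁, σ₂) ∈ D → (σ₁.neg, σ₂) ∈ D
  between_mem : ∀ σ₁ σ₂ σ₃, (σ₁, σ₃) ∈ D → LiesBetween σ₂ σ₁ σ₃ →
    (σ₁, σ₂) ∈ D ∧ (σ₂, σ₃) ∈ D
  nonneg : ∀ σ₁ σ₂, (σ₁, σ₂) ∈ D → 0 ≤ θ σ₁ σ₂
  le_pi : ∀ σ₁ σ₂, (σ₁, σ₂) ∈ D → θ σ₁ σ₂ ≤ Real.pi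
  eq_zero_iff : ∀ σ₁ σ₂, (σ₁, σ₂) ∈ D → (θ σ₁ σ₂ = 0 ↔ σ₁ = σ₂)
  eq_pi_iff : ∀ σ₁ σ₂, (σ₁, σ₂) ∈ D → (θ σ₁ σ₂ = Real.pi ↔ σ₁ = σ₂.neg)
  act : ∀ σ₁ σ₂, (σ₁, σ₂) ∈ D → ∀ g, θ (σ₁.act g) (σ₂.act g) = θ σ₁ σ₂
  swap : ∀ σ₁ σ₂, (σ₁, σ₂) ∈ D → θ σ₂ σ₁ = θ σ₁ σ₂
  neg : ∀ σ₁ σ₂, (σ₁, σ₂) ∈ D → θ σ₁.neg σ₂ = Real.pi - θ σ₁ σ₂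
  additive : ∀ σ₁ σ₂ σ₃, (σ₁, σ₃) ∈ D → LiesBetween σ₂ σ₁ σ₃ →
    θ σ₁ σ₂ + θ σ₂ σ₃ = θ σ₁ σ₃

/-- `det (A - z B)` for a complex number `z`. -/
noncomputable def pencilDet {n : ℕ} (A B : Mat n) (z : ℂ) : ℂ :=
  (A.map Complex.ofReal - z • B.map Complex.ofReal).det

/-- The pencil `(A, B)` is regular: `det (A - z B) ≠ 0` for some complex number `z`. -/
def IsRegularPencil {n : ℕ} (A B : Mat n) : Prop :=
  ∃ z : ℂ, pencilDet A B z ≠ 0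

/-- The set of generalized eigenvalues of the pencil `(A, B)` in `ℂ ∪ {∞}`: a complex number `z`
is one when `A - z B` is singular, and `∞` is one when `B` is singular. -/
def genEigenvalues {n : ℕ} (A B : Mat n) : Set (OnePoint ℂ) :=
  (fun z : ℂ => (z : OnePoint ℂ)) '' {z | pencilDet A B z = 0} ∪
    {w | w = OnePoint.infty ∧ B.det = 0}

/-- The real numbers inside `ℂ ∪ {∞}`. -/
def realPoint (x : ℝ) : OnePoint ℂ := ((x : ℂ) : OnePoint ℂ)

/-- The extended real line `ℝ ∪ {∞}` inside `ℂ ∪ {∞}`. -/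
def extendedReals : Set (OnePoint ℂ) := insert OnePoint.infty (Set.range realPoint)

/-- Regular pencils with at least one nonreal generalized eigenvalue. -/
def IsTypeOne {n : ℕ} (A B : Mat n) : Prop :=
  IsRegularPencil A B ∧ ¬ genEigenvalues A B ⊆ extendedReals

/-- Regular pencils with at least three distinct generalized eigenvalues, all real or `∞`. -/
def IsTypeTwo {n : ℕ} (A B : Mat n) : Prop :=
  IsRegularPencil A B ∧ genEigenvalues A B ⊆ extendedReals ∧ 3 ≤ (genEigenvalues A B).encard

/-- Regular pencils with at most two distinct generalized eigenvalues, all real or `∞`. -/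
def IsTypeThree {n : ℕ} (A B : Mat n) : Prop :=
  IsRegularPencil A B ∧ genEigenvalues A B ⊆ extendedReals ∧ (genEigenvalues A B).encard ≤ 2

/-- The pairs of co-oriented hyperplanes `(A^⊥, B^⊥)` whose pencil `(A, B)` satisfies `T`. -/
def pairsWith {n : ℕ} (T : Mat n → Mat n → Prop) :
    Set (CoHyperplane n × CoHyperplane n) :=
  {s | ∃ A B : NormalVector n, s = (A.perp, B.perp) ∧ T A.mat B.mat}

/-- `λ₁, …, λ_k, λ₁*, …, λ_k*` lists the distinct nonreal generalized eigenvalues of `(A, B)`,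
each exactly once. -/
def ListsNonreal {n k : ℕ} (A B : Mat n) (l : Fin k → ℂ) : Prop :=
  Function.Injective (Sum.elim l (fun i => (starRingEnd ℂ) (l i))) ∧
    Set.range (Sum.elim l (fun i => (starRingEnd ℂ) (l i))) =
      {z : ℂ | (z : OnePoint ℂ) ∈ genEigenvalues A B ∧ z.im ≠ 0}

/-- The radicand
`(∑ 1 / (λ_{i+1} - λ_i)) (∑ (λ_{i+1} + λ_i)² / (λ_{i+1} - λ_i))`, indices modulo `k`. -/
noncomputable def radicand {k : ℕ} (l : Fin k → ℝ) : ℝ :=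
  (∑ i, 1 / (l (finRotate k i) - l i)) *
    (∑ i, (l (finRotate k i) + l i) ^ 2 / (l (finRotate k i) - l i))

/-- The quotient `(∑ (λ_{i+1} + λ_i) / (λ_{i+1} - λ_i)) / √radicand`, indices modulo `k`. -/
noncomputable def cosQuotient {k : ℕ} (l : Fin k → ℝ) : ℝ :=
  (∑ i, (l (finRotate k i) + l i) / (l (finRotate k i) - l i)) / Real.sqrt (radicand l)

end SelbergSpace

open SelbergSpace

/-! Everything happens in the plane spanned by `A` and `B`, with its singular members marked.
Positive scaling, exchange, sign change and subdivision are real changes of basis of this plane and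
move the generalized eigenvalues by real Möbius transformations; congruence leaves them fixed. So an
invariant angle function arises whenever the eigenvalues determine, equivariantly, a way of
measuring angles in the plane. `IsMatrixAngle` isolates what must be checked on matrices, and
`IsMatrixAngle.isInvariantAngleFunction` passes to hyperplanes.

A nonreal eigenvalue `z` identifies the plane with `ℂ` so that `A` and `B` become `z` and `1`; their
angle is `|arg z|`, and averaging over all nonreal eigenvalues keeps additivity
(`isMatrixAngle_meanArg`).

Real eigenvalues are the vertices of an ideal polygon in the hyperbolic plane. Each side carries an
indefinite binary form vanishing at its two ends, normalized by its discriminant, with sign fixed by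
the orientation. The sum over the sides is equivariant up to a positive factor (`polygonForm_image`)
and positive definite once there are three vertices (`polygonForm_self_pos`). The angle of `A` and
`B` for this form is the one in the theorem: the cyclic sums are its Gram entries, up to constants.

With at most two eigenvalues, the plane has a basis `M₁`, `M₂` outside whose lines no member is
singular. Some element of `SL(n,ℝ)` scales `M₁` and `M₂` by different positive factors
(`exists_specialLinear_scaling`), so its powers push a suitable hyperplane monotonically without
ever leaving the given angle. The successive angles are equal and positive, hence their sum exceeds
`π` (`IsInvariantAngleFunction.not_mem_of_orbit`). -/

namespace SelbergSpace

/-! ### Angles of pairs of matrices -/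

/-- A function on pairs of matrices in a class `T` which descends to an invariant angle function. -/
structure IsMatrixAngle {n : ℕ} (T : Mat n → Mat n → Prop) (ϑ : Mat n → Mat n → ℝ) : Prop where
  smul : ∀ {A B}, T A B → ∀ {c d : ℝ}, 0 < c → 0 < d →
    T (c • A) (d • B) ∧ ϑ (c • A) (d • B) = ϑ A B
  conj : ∀ {A B}, T A B → ∀ {h : Mat n}, h.det ≠ 0 →
    T (h * A * hᵀ) (h * B * hᵀ) ∧ ϑ (h * A * hᵀ) (h * B * hᵀ) = ϑ A B
  swap : ∀ {A B}, T A B → T B A ∧ ϑ B A = ϑ A B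
  neg : ∀ {A B}, T A B → T (-A) B ∧ ϑ (-A) B = Real.pi - ϑ A B
  between : ∀ {A B}, T A B → ∀ {p q : ℝ}, 0 < p → 0 < q →
    T A (p • A + q • B) ∧ T (p • A + q • B) B ∧
      ϑ A (p • A + q • B) + ϑ (p • A + q • B) B = ϑ A B
  pos : ∀ {A B}, T A B → 0 < ϑ A B
  lt_pi : ∀ {A B}, T A B → ϑ A B < Real.pi

theorem NormalVector.exists_smul_of_perp_eq {n : ℕ} {A B : NormalVector n}
    (h : A.perp = B.perp) : ∃ c : ℝ, 0 < c ∧ B.mat = c • A.mat :=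
  Quotient.exact h

theorem NormalVector.perp_eq_of_smul {n : ℕ} {A B : NormalVector n} {c : ℝ} (hc : 0 < c)
    (h : B.mat = c • A.mat) : A.perp = B.perp :=
  Quotient.sound ⟨c, hc, h⟩

/-- The function on pairs of co-oriented hyperplanes induced by a function of normal vectors. -/
noncomputable def hyperplaneAngle {n : ℕ} (ϑ : Mat n → Mat n → ℝ) (σ₁ σ₂ : CoHyperplane n) : ℝ :=
  ϑ (Quotient.out σ₁).mat (Quotient.out σ₂).mat

namespace IsMatrixAngle

variable {n : ℕ} {T : Mat n → Mat n → Prop} {ϑ : Mat n → Mat n → ℝ}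

theorem hyperplaneAngle_perp (H : IsMatrixAngle T ϑ) {A B : NormalVector n}
    (h : T A.mat B.mat) : hyperplaneAngle ϑ A.perp B.perp = ϑ A.mat B.mat := by
  obtain ⟨c, hc, e⟩ := NormalVector.exists_smul_of_perp_eq
    (A := A) (B := Quotient.out A.perp) (Quotient.out_eq _).symm
  obtain ⟨d, hd, e'⟩ := NormalVector.exists_smul_of_perp_eq
    (A := B) (B := Quotient.out B.perp) (Quotient.out_eq _).symm
  rw [hyperplaneAngle, e, e', (H.smul h hc hd).2]

theorem mem_pairsWith_iff (H : IsMatrixAngle T ϑ) {A B : NormalVector n} :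
    (A.perp, B.perp) ∈ pairsWith T ↔ T A.mat B.mat := by
  refine ⟨?_, fun h => ⟨A, B, rfl, h⟩⟩
  rintro ⟨A', B', e, h⟩
  obtain ⟨e₁, e₂⟩ := Prod.mk.inj e
  obtain ⟨c, hc, e⟩ := NormalVector.exists_smul_of_perp_eq e₁.symm
  obtain ⟨d, hd, e'⟩ := NormalVector.exists_smul_of_perp_eq e₂.symm
  rw [e, e']
  exact (H.smul h hc hd).1

/-- The midpoint of `A` and `A` is `A`, so additivity would give `2ϑ = ϑ`, against positivity. -/
theorem not_self (H : IsMatrixAngle T ϑ) (A : Mat n) : ¬ T A A := by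
  intro h
  obtain ⟨-, -, e⟩ := H.between h (p := 1 / 2) (q := 1 / 2) (by norm_num) (by norm_num)
  have hA : (1 / 2 : ℝ) • A + (1 / 2 : ℝ) • A = A := by rw [← add_smul]; norm_num
  rw [hA] at e
  have := H.pos h
  linarith

theorem det_inv_ne_zero (g : SL n) : (↑g⁻¹ : Mat n).det ≠ 0 := by
  rw [Matrix.SpecialLinearGroup.det_coe]; exact one_ne_zero

/-- By `not_self` and stability under sign change, no pair in the domain consists of equal or
opposite hyperplanes. In the clauses for the values `0` and `π` both sides are therefore false. -/
theorem isInvariantAngleFunction (H : IsMatrixAngle T ϑ) :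
    IsInvariantAngleFunction (pairsWith T) (hyperplaneAngle ϑ) := by
  have key : ∀ {P : CoHyperplane n → CoHyperplane n → Prop},
      (∀ A B : NormalVector n, T A.mat B.mat → P A.perp B.perp) →
      ∀ σ₁ σ₂, (σ₁, σ₂) ∈ pairsWith T → P σ₁ σ₂ := by
    rintro P hP σ₁ σ₂ ⟨A, B, e, h⟩
    obtain ⟨rfl, rfl⟩ := Prod.mk.inj e
    exact hP A B h
  have hbetween : ∀ σ₁ σ₂ σ₃, (σ₁, σ₃) ∈ pairsWith T → LiesBetween σ₂ σ₁ σ₃ →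
      ∃ A₁ A₂ A₃ : NormalVector n, A₁.perp = σ₁ ∧ A₂.perp = σ₂ ∧ A₃.perp = σ₃ ∧
        T A₁.mat A₃.mat ∧ T A₁.mat A₂.mat ∧ T A₂.mat A₃.mat ∧
          ϑ A₁.mat A₂.mat + ϑ A₂.mat A₃.mat = ϑ A₁.mat A₃.mat := by
    rintro σ₁ σ₂ σ₃ h ⟨A₁, A₂, A₃, rfl, rfl, rfl, p, q, hp, hq, e⟩
    rw [H.mem_pairsWith_iff] at h
    have := H.between h hp hq
    rw [← e] at this
    exact ⟨A₁, A₂, A₃, rfl, rfl, rfl, h, this⟩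
  refine
    { act_mem := key fun A B h g => ⟨A.act g, B.act g, rfl, (H.conj h (det_inv_ne_zero g)).1⟩
      swap_mem := key fun A B h => ⟨B, A, rfl, (H.swap h).1⟩
      neg_mem := key fun A B h => ⟨A.neg, B, rfl, (H.neg h).1⟩
      between_mem := ?_
      nonneg := key fun A B h => by rw [H.hyperplaneAngle_perp h]; exact (H.pos h).le
      le_pi := key fun A B h => by rw [H.hyperplaneAngle_perp h]; exact (H.lt_pi h).le
      eq_zero_iff := key fun A B h => ?_
      eq_pi_iff := key fun A B h => ?_
      act := key fun A B h g => ?_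
      swap := key fun A B h => ?_
      neg := key fun A B h => ?_
      additive := ?_ }
  · intro σ₁ σ₂ σ₃ h hb
    obtain ⟨A₁, A₂, A₃, rfl, rfl, rfl, h₁₃, h₁₂, h₂₃, -⟩ := hbetween σ₁ σ₂ σ₃ h hb
    exact ⟨⟨A₁, A₂, rfl, h₁₂⟩, ⟨A₂, A₃, rfl, h₂₃⟩⟩
  · rw [H.hyperplaneAngle_perp h]
    refine ⟨fun h0 => absurd h0 (H.pos h).ne', fun e => ?_⟩
    have : (A.perp, A.perp) ∈ pairsWith T := by
      nth_rw 2 [e]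
      exact H.mem_pairsWith_iff.mpr h
    exact absurd (H.mem_pairsWith_iff.mp this) (H.not_self _)
  · rw [H.hyperplaneAngle_perp h]
    refine ⟨fun h0 => absurd h0 (H.lt_pi h).ne, fun e => ?_⟩
    have : (B.neg.perp, B.perp) ∈ pairsWith T := by
      rw [show B.neg.perp = B.perp.neg from rfl, ← e]
      exact H.mem_pairsWith_iff.mpr h
    have h' := (H.neg (H.mem_pairsWith_iff.mp this)).1
    rw [NormalVector.neg, neg_neg] at h'
    exact absurd h' (H.not_self _)
  · have h' := H.conj h (det_inv_ne_zero g)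
    rw [show A.perp.act g = (A.act g).perp from rfl, show B.perp.act g = (B.act g).perp from rfl,
      H.hyperplaneAngle_perp h, H.hyperplaneAngle_perp (A := A.act g) (B := B.act g) h'.1]
    exact h'.2
  · rw [H.hyperplaneAngle_perp h, H.hyperplaneAngle_perp (H.swap h).1, (H.swap h).2]
  · rw [show A.perp.neg = A.neg.perp from rfl, H.hyperplaneAngle_perp h,
      H.hyperplaneAngle_perp (A := A.neg) (H.neg h).1]
    exact (H.neg h).2
  · intro σ₁ σ₂ σ₃ h hb
    obtain ⟨A₁, A₂, A₃, rfl, rfl, rfl, h₁₃, h₁₂, h₂₃, e⟩ := hbetween σ₁ σ₂ σ₃ h hb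
    rw [H.hyperplaneAngle_perp h₁₃, H.hyperplaneAngle_perp h₁₂, H.hyperplaneAngle_perp h₂₃, e]

end IsMatrixAngle

/-! ### Transformations of pencils -/

/-- The homogeneous form `det (x A + y B)` over the complex numbers. -/
noncomputable def pencilForm {n : ℕ} (A B : Mat n) (x y : ℂ) : ℂ :=
  (x • A.map Complex.ofReal + y • B.map Complex.ofReal).det

theorem pencilForm_smul {n : ℕ} (A B : Mat n) (c x y : ℂ) :
    pencilForm A B (c * x) (c * y) = c ^ n * pencilForm A B x y := by
  rw [pencilForm, pencilForm, mul_smul, mul_smul, ← smul_add, det_smul, Fintype.card_fin]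

theorem pencilDet_eq_pencilForm {n : ℕ} (A B : Mat n) (z : ℂ) :
    pencilDet A B z = pencilForm A B 1 (-z) := by
  rw [pencilDet, pencilForm, one_smul, neg_smul, sub_eq_add_neg]

theorem pencilForm_eq_zero_iff {n : ℕ} (A B : Mat n) {x : ℂ} (hx : x ≠ 0) (y : ℂ) :
    pencilForm A B x y = 0 ↔ pencilDet A B (-y / x) = 0 := by
  have : pencilForm A B x y = x ^ n * pencilDet A B (-y / x) := by
    rw [pencilDet_eq_pencilForm, ← pencilForm_smul]
    congr 1 <;> field_simp
  rw [this, mul_eq_zero, or_iff_right (pow_ne_zero _ hx)]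

theorem pencilForm_comb {n : ℕ} (A B : Mat n) (a b c d : ℝ) (x y : ℂ) :
    pencilForm (a • A + b • B) (c • A + d • B) x y =
      pencilForm A B (x * a + y * c) (x * b + y * d) := by
  unfold pencilForm
  congr 1
  ext i j
  simp
  ring

theorem pencilForm_conj {n : ℕ} (A B h : Mat n) (x y : ℂ) :
    pencilForm (h * A * hᵀ) (h * B * hᵀ) x y = (h.det : ℂ) ^ 2 * pencilForm A B x y := by
  have e : ∀ C : Mat n, (h * C * hᵀ).map Complex.ofReal =
      h.map Complex.ofReal * C.map Complex.ofReal * (h.map Complex.ofReal)ᵀ := by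
    intro C
    change (h * C * hᵀ).map Complex.ofRealHom =
      h.map Complex.ofRealHom * C.map Complex.ofRealHom * (h.map Complex.ofRealHom)ᵀ
    rw [Matrix.map_mul, Matrix.map_mul, Matrix.transpose_map]
  have hd : (h.map Complex.ofReal).det = (h.det : ℂ) := (RingHom.map_det Complex.ofRealHom h).symm
  have : x • (h * A * hᵀ).map Complex.ofReal + y • (h * B * hᵀ).map Complex.ofReal =
      h.map Complex.ofReal * (x • A.map Complex.ofReal + y • B.map Complex.ofReal) *
        (h.map Complex.ofReal)ᵀ := by
    rw [e, e]
    simp only [Matrix.mul_add, Matrix.add_mul, Matrix.mul_smul, Matrix.smul_mul]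
  rw [pencilForm, this, det_mul, det_mul, det_transpose, hd, pencilForm]
  ring

theorem pencilDet_conj_eq_zero_iff {n : ℕ} (A B : Mat n) {h : Mat n} (hh : h.det ≠ 0) (z : ℂ) :
    pencilDet (h * A * hᵀ) (h * B * hᵀ) z = 0 ↔ pencilDet A B z = 0 := by
  rw [pencilDet_eq_pencilForm, pencilForm_conj, ← pencilDet_eq_pencilForm, mul_eq_zero,
    or_iff_right (pow_ne_zero _ (Complex.ofReal_ne_zero.mpr hh))]

/-- The set of roots of a regular pencil is finite. -/
theorem finite_pencilDet_eq_zero {n : ℕ} {A B : Mat n} (h : IsRegularPencil A B) :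
    {z | pencilDet A B z = 0}.Finite := by
  let P : Polynomial ℂ := ((A.map Complex.ofReal).map Polynomial.C -
    (Polynomial.X : Polynomial ℂ) • (B.map Complex.ofReal).map Polynomial.C).det
  have hP : ∀ z, P.eval z = pencilDet A B z := by
    intro z
    rw [pencilDet, ← Polynomial.coe_evalRingHom, RingHom.map_det]
    congr 1
    ext i j
    simp; ring
  obtain ⟨z, hz⟩ := h
  have hP0 : P ≠ 0 := by
    intro h0
    rw [← hP, h0, Polynomial.eval_zero] at hz
    exact hz rfl
  refine (P.roots.toFinset.finite_toSet).subset fun w hw => ?_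
  simp only [Finset.mem_coe, Multiset.mem_toFinset, Polynomial.mem_roots hP0, Polynomial.IsRoot]
  rw [hP]
  exact hw

theorem coe_mem_genEigenvalues {n : ℕ} {A B : Mat n} {z : ℂ} :
    (z : OnePoint ℂ) ∈ genEigenvalues A B ↔ pencilDet A B z = 0 := by
  simp [genEigenvalues]

theorem infty_mem_genEigenvalues {n : ℕ} {A B : Mat n} :
    OnePoint.infty ∈ genEigenvalues A B ↔ B.det = 0 := by
  simp [genEigenvalues]

theorem coe_mem_extendedReals {z : ℂ} : (z : OnePoint ℂ) ∈ extendedReals ↔ z.im = 0 := by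
  simp only [extendedReals, Set.mem_insert_iff, OnePoint.coe_ne_infty, false_or, Set.mem_range,
    realPoint, OnePoint.coe_eq_coe]
  exact ⟨fun ⟨x, hx⟩ => by rw [← hx, Complex.ofReal_im], fun h => ⟨z.re, Complex.ext rfl h.symm⟩⟩

theorem genEigenvalues_subset_extendedReals_iff {n : ℕ} {A B : Mat n} :
    genEigenvalues A B ⊆ extendedReals ↔ ∀ z, pencilDet A B z = 0 → z.im = 0 := by
  refine ⟨fun h z hz => coe_mem_extendedReals.mp (h (coe_mem_genEigenvalues.mpr hz)), ?_⟩
  intro h w hw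
  induction w using OnePoint.rec with
  | infty => exact Set.mem_insert _ _
  | coe z => exact coe_mem_extendedReals.mpr (h z (coe_mem_genEigenvalues.mp hw))

theorem infinite_nonreal : {z : ℂ | z.im ≠ 0}.Infinite := by
  refine Set.infinite_of_injective_forall_mem (f := fun k : ℕ => (((k : ℝ) + 1 : ℝ) : ℂ) * Complex.I)
    ?_ ?_
  · intro i j h
    have := congrArg Complex.im h
    simpa using this
  · intro k
    simp
    positivity

/-- A nonreal point is never a pole of a real Möbius transformation, so a nonreal witness of
regularity can be carried to any other basis of the pencil. -/
theorem IsRegularPencil.exists_nonreal {n : ℕ} {A B : Mat n} (h : IsRegularPencil A B) :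
    ∃ z : ℂ, z.im ≠ 0 ∧ pencilDet A B z ≠ 0 := by
  obtain ⟨z, hz, hz'⟩ := infinite_nonreal.exists_notMem_finite (finite_pencilDet_eq_zero h)
  exact ⟨z, hz, hz'⟩

/-- The nonreal roots of the pencil. -/
def nonrealRoots {n : ℕ} (A B : Mat n) : Set ℂ := {z | z.im ≠ 0 ∧ pencilDet A B z = 0}

/-- The real Möbius transformation `z ↦ (a z + b) / (c z + d)`. -/
noncomputable def moebius (a b c d : ℝ) (z : ℂ) : ℂ := (a * z + b) / (c * z + d)

/-! ### Real Möbius transformations acting on nonreal points. -/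

section Moebius

variable {a b c d : ℝ} (had : a * d - b * c ≠ 0) {z : ℂ} (hz : z.im ≠ 0)
include had hz

theorem moebius_denom_ne_zero : (c * z + d : ℂ) ≠ 0 := by
  intro h
  have h1 := congrArg Complex.im h
  have h2 := congrArg Complex.re h
  simp at h1 h2
  obtain rfl : c = 0 := by tauto
  obtain rfl : d = 0 := by simpa using h2
  simp at had

theorem moebius_mul_denom : moebius a b c d z * (c * z + d) = a * z + b :=
  div_mul_cancel₀ _ (moebius_denom_ne_zero had hz)

omit had hz in
theorem moebius_im : (moebius a b c d z).im =
    (a * d - b * c) * z.im / Complex.normSq (c * z + d) := by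
  rw [moebius, Complex.div_im]
  simp
  ring

theorem moebius_im_ne_zero : (moebius a b c d z).im ≠ 0 := by
  rw [moebius_im]
  have := Complex.normSq_pos.mpr (moebius_denom_ne_zero had hz)
  positivity

theorem moebius_moebius : moebius d (-b) (-c) a (moebius a b c d z) = z := by
  have h1 := moebius_denom_ne_zero had hz
  have h2 : (a * d - b * c : ℂ) ≠ 0 := by exact_mod_cast had
  have hw := moebius_mul_denom had hz
  generalize moebius a b c d z = w at hw
  have h3 : ((-c : ℝ) : ℂ) * w + a = (a * d - b * c) / (c * z + d) := by
    rw [eq_div_iff h1]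
    push_cast
    linear_combination (-c : ℂ) * hw
  rw [moebius, h3, div_eq_iff (div_ne_zero h2 h1), mul_div_assoc', eq_div_iff h1]
  push_cast
  linear_combination (d : ℂ) * hw

/-- With `w` the image of `z`, the base change takes the coordinates `(1, -w)` to `(1, -z)` times
`(ad - bc)/(cz + d)`, and the determinant form is homogeneous. -/
theorem pencilDet_moebius_eq_zero_iff {n : ℕ} (A B : Mat n) :
    pencilDet (a • A + b • B) (c • A + d • B) (moebius a b c d z) = 0 ↔ pencilDet A B z = 0 := by
  have h1 := moebius_denom_ne_zero had hz
  have h2 : (a * d - b * c : ℂ) ≠ 0 := by exact_mod_cast had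
  have h3 : (1 * a + -moebius a b c d z * c : ℂ) = (a * d - b * c) / (c * z + d) * 1 := by
    rw [div_mul_eq_mul_div, eq_div_iff h1]
    linear_combination (-c : ℂ) * moebius_mul_denom had hz
  have h4 : (1 * b + -moebius a b c d z * d : ℂ) = (a * d - b * c) / (c * z + d) * (-z) := by
    rw [div_mul_eq_mul_div, eq_div_iff h1]
    linear_combination (-d : ℂ) * moebius_mul_denom had hz
  rw [pencilDet_eq_pencilForm, pencilForm_comb, h3, h4, pencilForm_smul, mul_eq_zero,
    or_iff_right (pow_ne_zero _ (div_ne_zero h2 h1)), ← pencilDet_eq_pencilForm]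

end Moebius

theorem nonrealRoots_comb {n : ℕ} (A B : Mat n) {a b c d : ℝ} (had : a * d - b * c ≠ 0) :
    nonrealRoots (a • A + b • B) (c • A + d • B) = moebius a b c d '' nonrealRoots A B := by
  ext w
  constructor
  · rintro ⟨hw, h⟩
    have had' : d * a - -b * -c ≠ 0 := by intro h; apply had; linarith
    have e := moebius_moebius had' hw
    simp only [neg_neg] at e
    have hz := moebius_im_ne_zero had' hw
    refine ⟨moebius d (-b) (-c) a w, ⟨hz, ?_⟩, e⟩
    rwa [← pencilDet_moebius_eq_zero_iff had hz, e]
  · rintro ⟨z, ⟨hz, h⟩, rfl⟩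
    exact ⟨moebius_im_ne_zero had hz, (pencilDet_moebius_eq_zero_iff had hz A B).mpr h⟩

theorem moebius_injOn {n : ℕ} (A B : Mat n) {a b c d : ℝ} (had : a * d - b * c ≠ 0) :
    Set.InjOn (moebius a b c d) (nonrealRoots A B) := by
  intro z hz w hw h
  rw [← moebius_moebius had hz.1, h, moebius_moebius had hw.1]

theorem nonrealRoots_conj {n : ℕ} (A B : Mat n) {h : Mat n} (hh : h.det ≠ 0) :
    nonrealRoots (h * A * hᵀ) (h * B * hᵀ) = nonrealRoots A B := by
  ext z
  simp only [nonrealRoots, Set.mem_ofPred_eq, pencilDet_conj_eq_zero_iff A B hh]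

theorem isRegularPencil_comb {n : ℕ} {A B : Mat n} (h : IsRegularPencil A B) {a b c d : ℝ}
    (had : a * d - b * c ≠ 0) : IsRegularPencil (a • A + b • B) (c • A + d • B) := by
  obtain ⟨z, hz, hz'⟩ := h.exists_nonreal
  exact ⟨_, (pencilDet_moebius_eq_zero_iff had hz A B).not.mpr hz'⟩

theorem isRegularPencil_conj {n : ℕ} {A B : Mat n} (h : IsRegularPencil A B) {g : Mat n}
    (hg : g.det ≠ 0) : IsRegularPencil (g * A * gᵀ) (g * B * gᵀ) := by
  obtain ⟨z, hz⟩ := h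
  exact ⟨z, (pencilDet_conj_eq_zero_iff A B hg z).not.mpr hz⟩

/-! ### Pencils with a nonreal generalized eigenvalue -/

theorem isTypeOne_iff {n : ℕ} {A B : Mat n} :
    IsTypeOne A B ↔ IsRegularPencil A B ∧ (nonrealRoots A B).Nonempty := by
  rw [IsTypeOne, genEigenvalues_subset_extendedReals_iff]
  refine and_congr_right fun _ => ?_
  simp [nonrealRoots, Set.Nonempty, and_comm]

/-- The mean of `|arg z|` over the nonreal roots `z` of the pencil. -/
noncomputable def meanArg {n : ℕ} (A B : Mat n) : ℝ :=
  (∑ᶠ z ∈ nonrealRoots A B, |z.arg|) / (nonrealRoots A B).ncard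

theorem finite_nonrealRoots {n : ℕ} {A B : Mat n} (h : IsRegularPencil A B) :
    (nonrealRoots A B).Finite :=
  (finite_pencilDet_eq_zero h).subset fun _ hz => hz.2

theorem IsTypeOne.comb {n : ℕ} {A B : Mat n} (h : IsTypeOne A B) {a b c d : ℝ}
    (had : a * d - b * c ≠ 0) : IsTypeOne (a • A + b • B) (c • A + d • B) := by
  rw [isTypeOne_iff] at h ⊢
  refine ⟨isRegularPencil_comb h.1 had, ?_⟩
  rw [nonrealRoots_comb A B had]
  exact h.2.image _

theorem meanArg_comb {n : ℕ} (A B : Mat n) {a b c d : ℝ} (had : a * d - b * c ≠ 0) :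
    meanArg (a • A + b • B) (c • A + d • B) =
      (∑ᶠ z ∈ nonrealRoots A B, |(moebius a b c d z).arg|) / (nonrealRoots A B).ncard := by
  rw [meanArg, nonrealRoots_comb A B had, finsum_mem_image (moebius_injOn A B had),
    Set.InjOn.ncard_image (moebius_injOn A B had)]

theorem abs_arg_pos {z : ℂ} (hz : z.im ≠ 0) : 0 < |z.arg| := by
  rw [abs_pos]
  intro h
  exact hz (Complex.arg_eq_zero_iff.mp h).2

theorem abs_arg_lt_pi {z : ℂ} (hz : z.im ≠ 0) : |z.arg| < Real.pi := by
  refine lt_of_le_of_ne (Complex.abs_arg_le_pi z) fun h => ?_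
  have : z.arg = Real.pi := by
    rcases abs_eq Real.pi_pos.le |>.mp h with h | h
    · exact h
    · exact absurd h (Complex.neg_pi_lt_arg z).ne'
  exact hz (Complex.arg_eq_pi_iff.mp this).2

theorem abs_arg_neg {z : ℂ} (hz : z.im ≠ 0) : |(-z).arg| = Real.pi - |z.arg| := by
  rcases lt_or_gt_of_ne hz with h | h
  · rw [Complex.arg_neg_eq_arg_add_pi_of_im_neg h, abs_of_neg (Complex.arg_neg_iff.mpr h),
      abs_of_nonneg]
    · ring
    · linarith [Complex.neg_pi_lt_arg z]
  · rw [Complex.arg_neg_eq_arg_sub_pi_of_im_pos h, abs_of_nonneg (Complex.arg_nonneg_iff.mpr h.le),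
      abs_of_nonpos]
    · ring
    · linarith [Complex.arg_le_pi z]

/-- All three numbers lie in the upper half plane, so their arguments lie in `(0, π)`. The two sides
agree modulo `2π` and differ by less than `2π`. This is additivity for one eigenvalue: the two
numbers on the left are its images for the pairs `(A, pA + qB)` and `(pA + qB, B)`. -/
theorem arg_div_add_arg {z : ℂ} (hz : 0 < z.im) {p q : ℝ} (hp : 0 < p) (hq : 0 < q) :
    (z / (p * z + q)).arg + (p * z + q).arg = z.arg := by
  have him : 0 < (p * z + q : ℂ).im := by simp; positivity
  have h0 : (p * z + q : ℂ) ≠ 0 := by intro h; rw [h] at him; simp at him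
  have hz0 : z ≠ 0 := by rintro rfl; simp at hz
  have him' : 0 < (z / (p * z + q)).im := by
    have := moebius_im (a := 1) (b := 0) (c := p) (d := q) (z := z)
    simp only [moebius] at this
    simp only [Complex.ofReal_one, one_mul, Complex.ofReal_zero, add_zero, zero_mul, sub_zero]
      at this
    rw [this]
    have := Complex.normSq_pos.mpr h0
    positivity
  have h1 : 0 < (z / (p * z + q)).arg ∧ (z / (p * z + q)).arg < Real.pi :=
    ⟨by simpa [abs_of_nonneg (Complex.arg_nonneg_iff.mpr him'.le)] using abs_arg_pos him'.ne',
      by simpa [abs_of_nonneg (Complex.arg_nonneg_iff.mpr him'.le)] using abs_arg_lt_pi him'.ne'⟩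
  have h2 : 0 < (p * z + q : ℂ).arg ∧ (p * z + q : ℂ).arg < Real.pi :=
    ⟨by simpa [abs_of_nonneg (Complex.arg_nonneg_iff.mpr him.le)] using abs_arg_pos him.ne',
      by simpa [abs_of_nonneg (Complex.arg_nonneg_iff.mpr him.le)] using abs_arg_lt_pi him.ne'⟩
  have h3 : 0 < z.arg ∧ z.arg < Real.pi :=
    ⟨by simpa [abs_of_nonneg (Complex.arg_nonneg_iff.mpr hz.le)] using abs_arg_pos hz.ne',
      by simpa [abs_of_nonneg (Complex.arg_nonneg_iff.mpr hz.le)] using abs_arg_lt_pi hz.ne'⟩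
  have e := Complex.arg_mul_coe_angle (div_ne_zero hz0 h0) h0
  rw [div_mul_cancel₀ _ h0, ← Real.Angle.coe_add, Real.Angle.angle_eq_iff_two_pi_dvd_sub] at e
  obtain ⟨k, hk⟩ := e
  have hk0 : k = 0 := by
    have hpi := Real.pi_pos
    have a1 : (-1 : ℝ) < k := by
      by_contra hc
      nlinarith
    have a2 : (k : ℝ) < 1 := by
      by_contra hc
      nlinarith
    have b1 : (-1 : ℤ) < k := by exact_mod_cast a1
    have b2 : k < (1 : ℤ) := by exact_mod_cast a2
    omega
  rw [hk0] at hk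
  simp at hk
  linarith

theorem abs_arg_conj (z : ℂ) : |((starRingEnd ℂ) z).arg| = |z.arg| := by
  rw [Complex.arg_conj]
  split_ifs with h
  · rw [h]
  · rw [abs_neg]

theorem abs_arg_div_add_abs_arg {z : ℂ} (hz : z.im ≠ 0) {p q : ℝ} (hp : 0 < p) (hq : 0 < q) :
    |(z / (p * z + q)).arg| + |(p * z + q).arg| = |z.arg| := by
  have key : ∀ {w : ℂ}, 0 < w.im → |(w / (p * w + q)).arg| + |(p * w + q).arg| = |w.arg| := by
    intro w hw
    have h := arg_div_add_arg hw hp hq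
    have him : 0 < (p * w + q : ℂ).im := by simp; positivity
    have h0 : (p * w + q : ℂ) ≠ 0 := by intro h; rw [h] at him; simp at him
    rw [abs_of_nonneg (Complex.arg_nonneg_iff.mpr him.le),
      abs_of_nonneg (Complex.arg_nonneg_iff.mpr hw.le), abs_of_nonneg, h]
    rw [Complex.arg_nonneg_iff, Complex.div_im]
    have := Complex.normSq_pos.mpr h0
    rw [← sub_div]
    apply div_nonneg _ this.le
    simp
    nlinarith [mul_pos hq hw]
  rcases lt_or_gt_of_ne hz with h | h
  · have := key (w := (starRingEnd ℂ) z) (by simpa using h)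
    rw [← abs_arg_conj z, ← this, ← abs_arg_conj (z / _), ← abs_arg_conj (p * z + q)]
    simp
  · exact key h

theorem finsum_mem_div_ncard_lt {s : Set ℂ} (hs : s.Finite) (hne : s.Nonempty) {f : ℂ → ℝ} {C : ℝ}
    (h : ∀ z ∈ s, f z < C) : (∑ᶠ z ∈ s, f z) / s.ncard < C := by
  have hc : 0 < s.ncard := (Set.ncard_pos hs).mpr hne
  rw [div_lt_iff₀ (by exact_mod_cast hc), finsum_mem_eq_finite_toFinset_sum _ hs,
    Set.ncard_eq_toFinset_card s hs]
  calc ∑ z ∈ hs.toFinset, f z < ∑ z ∈ hs.toFinset, C :=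
        Finset.sum_lt_sum_of_nonempty (by simpa using hne) fun z hz => h z (by simpa using hz)
    _ = C * _ := by rw [Finset.sum_const, nsmul_eq_mul, mul_comm]

/-- Each operation other than congruence is a base change and reindexes the nonreal roots by a
Möbius map. What remains are identities root by root, for `z` times a positive number, `z⁻¹`, `-z`,
and the splitting of `z` at `pz + q`. -/
theorem isMatrixAngle_meanArg (n : ℕ) :
    IsMatrixAngle (IsTypeOne (n := n)) meanArg := by
  have hfin : ∀ {A B : Mat n}, IsTypeOne A B → (nonrealRoots A B).Finite :=
    fun h => finite_nonrealRoots h.1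
  have hne : ∀ {A B : Mat n}, IsTypeOne A B → (nonrealRoots A B).Nonempty :=
    fun h => (isTypeOne_iff.mp h).2
  have hcard : ∀ {A B : Mat n}, IsTypeOne A B → ((nonrealRoots A B).ncard : ℝ) ≠ 0 := by
    intro A B h
    exact_mod_cast ((Set.ncard_pos (hfin h)).mpr (hne h)).ne'
  refine ⟨?_, ?_, ?_, ?_, ?_, ?_, ?_⟩
  · intro A B h c d hc hd
    have had : c * d - 0 * 0 ≠ 0 := by simp [hc.ne', hd.ne']
    have e1 : c • A = c • A + (0 : ℝ) • B := by simp
    have e2 : d • B = (0 : ℝ) • A + d • B := by simp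
    rw [e1, e2]
    refine ⟨h.comb had, ?_⟩
    rw [meanArg_comb A B had, meanArg]
    congr 1
    refine finsum_mem_congr rfl fun z hz => ?_
    have : moebius c 0 0 d z = ((c / d : ℝ) : ℂ) * z := by
      simp [moebius]; ring
    rw [this, Complex.arg_real_mul _ (by positivity)]
  · intro A B h g hg
    rw [isTypeOne_iff] at h ⊢
    rw [meanArg, meanArg, nonrealRoots_conj A B hg]
    exact ⟨⟨isRegularPencil_conj h.1 hg, h.2⟩, rfl⟩
  · intro A B h
    have had : (0 : ℝ) * 0 - 1 * 1 ≠ 0 := by norm_num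
    have e1 : B = (0 : ℝ) • A + (1 : ℝ) • B := by simp
    have e2 : A = (1 : ℝ) • A + (0 : ℝ) • B := by simp
    have h' := h.comb had
    have h'' := meanArg_comb A B had
    rw [← e1, ← e2] at h' h''
    refine ⟨h', ?_⟩
    rw [h'', meanArg]
    congr 1
    refine finsum_mem_congr rfl fun z hz => ?_
    have : moebius 0 1 1 0 z = z⁻¹ := by simp [moebius]
    rw [this, Complex.abs_arg_inv]
  · intro A B h
    have had : (-1 : ℝ) * 1 - 0 * 0 ≠ 0 := by norm_num
    have e1 : -A = (-1 : ℝ) • A + (0 : ℝ) • B := by simp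
    have e2 : B = (0 : ℝ) • A + (1 : ℝ) • B := by simp
    have h' := h.comb had
    have h'' := meanArg_comb A B had
    rw [← e1, ← e2] at h' h''
    refine ⟨h', ?_⟩
    have : ∑ᶠ z ∈ nonrealRoots A B, |(moebius (-1) 0 0 1 z).arg| =
        Real.pi * (nonrealRoots A B).ncard - ∑ᶠ z ∈ nonrealRoots A B, |z.arg| := by
      rw [finsum_mem_congr rfl (g := fun z => Real.pi - |z.arg|), finsum_mem_sub_distrib _ _ (hfin h),
        finsum_mem_eq_finite_toFinset_sum (fun _ => Real.pi) (hfin h), Finset.sum_const,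
        nsmul_eq_mul, Set.ncard_eq_toFinset_card _ (hfin h), mul_comm]
      intro z hz
      have : moebius (-1) 0 0 1 z = -z := by simp [moebius]
      rw [this, abs_arg_neg hz.1]
    rw [h'', this, meanArg]
    have := hcard h
    field_simp
  · intro A B h p q hp hq
    have had : (1 : ℝ) * q - 0 * p ≠ 0 := by simpa using hq.ne'
    have had' : p * (1 : ℝ) - q * 0 ≠ 0 := by simpa using hp.ne'
    have e1 : A = (1 : ℝ) • A + (0 : ℝ) • B := by simp
    have e2 : B = (0 : ℝ) • A + (1 : ℝ) • B := by simp
    have h1 := h.comb had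
    have h2 := meanArg_comb A B had
    have h3 := h.comb had'
    have h4 := meanArg_comb A B had'
    rw [← e1] at h1 h2
    rw [← e2] at h3 h4
    refine ⟨h1, h3, ?_⟩
    rw [h2, h4, ← add_div, ← finsum_mem_add_distrib (hfin h), meanArg]
    congr 1
    refine finsum_mem_congr rfl fun z hz => ?_
    rw [← abs_arg_div_add_abs_arg hz.1 hp hq]
    simp [moebius]
  · intro A B h
    have := finsum_mem_div_ncard_lt (hfin h) (hne h) (f := fun z => -|z.arg|) (C := 0)
      fun z hz => neg_neg_of_pos (abs_arg_pos hz.1)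
    rw [finsum_mem_neg_distrib _ (hfin h), neg_div] at this
    rw [meanArg]
    linarith
  · intro A B h
    exact finsum_mem_div_ncard_lt (hfin h) (hne h) fun z hz => abs_arg_lt_pi hz.1

/-- Conjugate roots have the same `|arg|`, so the mean over all nonreal roots equals the mean over
one of each pair. -/
theorem meanArg_eq_of_listsNonreal {n k : ℕ} {A B : Mat n} {l : Fin k → ℂ}
    (h : ListsNonreal A B l) :
    meanArg A B = (1 / (k : ℝ)) * ∑ i, |Complex.arg (l i)| := by
  obtain ⟨hinj, hr⟩ := h
  have hN : nonrealRoots A B =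
      Set.range (Sum.elim l (fun i => (starRingEnd ℂ) (l i))) := by
    rw [hr]
    ext z
    simp only [nonrealRoots, Set.mem_ofPred_eq, coe_mem_genEigenvalues, and_comm]
  have hc : ((nonrealRoots A B).ncard : ℝ) = 2 * k := by
    rw [hN, ← Set.image_univ, Set.ncard_image_of_injective _ hinj, Set.ncard_univ]
    simp
    ring
  rw [meanArg, hc, hN, finsum_mem_range hinj, finsum_eq_sum_of_fintype, Fintype.sum_sum_type]
  simp only [Sum.elim_inl, Sum.elim_inr, abs_arg_conj]
  -- For `k = 0` both sides vanish because division by zero gives zero.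
  rcases eq_or_ne (k : ℝ) 0 with h0 | h0
  · simp [h0]
  · field_simp
    ring

/-! ### The quadratic form of a finite set of points of the real projective line -/

/-- Homogeneous coordinates of a point of the real projective line. -/
def homCoord : OnePoint ℝ → ℝ × ℝ := fun w => w.elim (1, 0) (fun x => (x, 1))

@[simp] theorem homCoord_infty : homCoord OnePoint.infty = (1, 0) := rfl

@[simp] theorem homCoord_coe (x : ℝ) : homCoord x = (x, 1) := rfl

/-- The area form of the plane. -/
def wedge (v w : ℝ × ℝ) : ℝ := v.2 * w.1 - v.1 * w.2

theorem wedge_smul_left (c : ℝ) (v w : ℝ × ℝ) : wedge (c • v) w = c * wedge v w := by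
  simp [wedge]; ring

theorem wedge_smul_right (c : ℝ) (v w : ℝ × ℝ) : wedge v (c • w) = c * wedge v w := by
  simp [wedge]; ring

theorem wedge_homCoord_ne_zero {a b : OnePoint ℝ} (h : a ≠ b) :
    wedge (homCoord a) (homCoord b) ≠ 0 := by
  induction a using OnePoint.rec <;> induction b using OnePoint.rec <;> simp [wedge] at h ⊢
  exact fun e => h (by linarith)

/-- The symmetric bilinear form with zero lines `a` and `b`, normalized to discriminant one. -/
noncomputable def pairForm (u v a b : ℝ × ℝ) : ℝ :=
  (wedge u a * wedge v b + wedge v a * wedge u b) / (2 * wedge a b)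

theorem pairForm_swap (u v a b : ℝ × ℝ) : pairForm u v b a = -pairForm u v a b := by
  have : 2 * wedge b a = -(2 * wedge a b) := by simp [wedge]; ring
  rw [pairForm, pairForm, this, div_neg]
  congr 2
  ring

theorem pairForm_smul (u v a b : ℝ × ℝ) {c d : ℝ} (hc : c ≠ 0) (hd : d ≠ 0) :
    pairForm u v (c • a) (d • b) = pairForm u v a b := by
  simp only [pairForm, wedge_smul_left, wedge_smul_right]
  rw [show c * wedge u a * (d * wedge v b) + c * wedge v a * (d * wedge u b) =
      (c * d) * (wedge u a * wedge v b + wedge v a * wedge u b) by ring,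
    show 2 * (d * (c * wedge a b)) = (c * d) * (2 * wedge a b) by ring,
    mul_div_mul_left _ _ (mul_ne_zero hc hd)]

/-- The sign of this number is the orientation of a triple of points. -/
def orient (a b c : OnePoint ℝ) : ℝ :=
  wedge (homCoord a) (homCoord b) * wedge (homCoord b) (homCoord c) *
    wedge (homCoord a) (homCoord c)

theorem orient_swap_left (a b c : OnePoint ℝ) : orient b a c = -orient a b c := by
  simp [orient, wedge]; ring

theorem orient_swap_right (a b c : OnePoint ℝ) : orient a c b = -orient a b c := by
  simp [orient, wedge]; ring

/-- `b` follows `a` in the cyclic order of `S`. -/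
def IsNext (S : Set (OnePoint ℝ)) (a b : OnePoint ℝ) : Prop :=
  a ∈ S ∧ b ∈ S ∧ a ≠ b ∧ ∀ c ∈ S, orient a c b ≤ 0

/-- The sum of the normalized forms attached to the sides of the ideal polygon with vertices
in `S`. -/
noncomputable def polygonForm (S : Set (OnePoint ℝ)) (u v : ℝ × ℝ) : ℝ :=
  ∑ᶠ p ∈ {p : OnePoint ℝ × OnePoint ℝ | IsNext S p.1 p.2},
    pairForm u v (homCoord p.1) (homCoord p.2)

theorem finite_isNext {S : Set (OnePoint ℝ)} (hS : S.Finite) :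
    {p : OnePoint ℝ × OnePoint ℝ | IsNext S p.1 p.2}.Finite :=
  (hS.prod hS).subset fun _ hp => ⟨hp.1, hp.2.1⟩

theorem polygonForm_eq_sum {S : Set (OnePoint ℝ)} (hS : S.Finite) (u v : ℝ × ℝ) :
    polygonForm S u v = ∑ p ∈ (finite_isNext hS).toFinset,
      pairForm u v (homCoord p.1) (homCoord p.2) :=
  finsum_mem_eq_finite_toFinset_sum _ _

/-- A plane vector `v` stands for the member `v.2 • A - v.1 • B`. Thus `(-y, x)` is `xA + yB`, while
`(0, 1)` and `(-1, 0)` are `A` and `B`: bilinearity written in the Gram entries of `A` and `B`. -/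
theorem polygonForm_expand {S : Set (OnePoint ℝ)} (hS : S.Finite) (x y x' y' : ℝ) :
    polygonForm S (-y, x) (-y', x') =
      x * x' * polygonForm S (0, 1) (0, 1) + (x * y' + x' * y) * polygonForm S (0, 1) (-1, 0) +
        y * y' * polygonForm S (-1, 0) (-1, 0) := by
  simp only [polygonForm_eq_sum hS, Finset.mul_sum, ← Finset.sum_add_distrib]
  refine Finset.sum_congr rfl fun p _ => ?_
  simp only [pairForm, wedge]
  ring

/-! ### Equivariance of the polygon form under `GL(2,ℝ)`. -/

/-- The linear action on the plane. -/
def planeAct (g : GL (Fin 2) ℝ) (v : ℝ × ℝ) : ℝ × ℝ :=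
  (g 0 0 * v.1 + g 0 1 * v.2, g 1 0 * v.1 + g 1 1 * v.2)

theorem det_entries_ne_zero (g : GL (Fin 2) ℝ) : g 0 0 * g 1 1 - g 0 1 * g 1 0 ≠ 0 := by
  have := g.det_ne_zero
  rwa [Matrix.det_fin_two] at this

theorem wedge_planeAct (g : GL (Fin 2) ℝ) (v w : ℝ × ℝ) :
    wedge (planeAct g v) (planeAct g w) =
      (g 0 0 * g 1 1 - g 0 1 * g 1 0) * wedge v w := by
  simp [wedge, planeAct]; ring

theorem exists_planeAct_homCoord (g : GL (Fin 2) ℝ) (w : OnePoint ℝ) :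
    ∃ c : ℝ, c ≠ 0 ∧ planeAct g (homCoord w) = c • homCoord (g • w) := by
  have hd := det_entries_ne_zero g
  induction w using OnePoint.rec with
  | infty =>
    rw [OnePoint.smul_infty_eq_ite]
    by_cases h : g 1 0 = 0
    · refine ⟨g 0 0, fun h' => hd (by rw [h, h']; ring), ?_⟩
      simp [planeAct, h]
    · refine ⟨g 1 0, h, ?_⟩
      rw [if_neg h]
      ext
      · simp [planeAct]; field_simp
      · simp [planeAct]
  | coe x =>
    rw [OnePoint.smul_some_eq_ite]
    by_cases h : g 1 0 * x + g 1 1 = 0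
    · refine ⟨g 0 0 * x + g 0 1, fun h' => ?_, ?_⟩
      · rcases eq_or_ne (g 1 0) 0 with h0 | h0
        · exact hd (by rw [h0] at h ⊢; linear_combination g 0 0 * h)
        · apply hd
          linear_combination g 0 0 * h - g 1 0 * h'
      · simp [planeAct, h]
    · refine ⟨g 1 0 * x + g 1 1, h, ?_⟩
      rw [if_neg h]
      ext
      · simp [planeAct, mul_div_cancel₀ _ h]
      · simp [planeAct]

theorem pairForm_planeAct (g : GL (Fin 2) ℝ) (u v : ℝ × ℝ) (a b : OnePoint ℝ) :
    pairForm (planeAct g u) (planeAct g v) (homCoord (g • a)) (homCoord (g • b)) =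
      (g 0 0 * g 1 1 - g 0 1 * g 1 0) * pairForm u v (homCoord a) (homCoord b) := by
  obtain ⟨c, hc, e⟩ := exists_planeAct_homCoord g a
  obtain ⟨d, hd, e'⟩ := exists_planeAct_homCoord g b
  rw [← pairForm_smul _ _ _ _ hc hd, ← e, ← e', pairForm, pairForm]
  simp only [wedge_planeAct]
  have := det_entries_ne_zero g
  set D := g 0 0 * g 1 1 - g 0 1 * g 1 0
  rw [show D * wedge u (homCoord a) * (D * wedge v (homCoord b)) +
      D * wedge v (homCoord a) * (D * wedge u (homCoord b)) =
      D * (D * (wedge u (homCoord a) * wedge v (homCoord b) +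
        wedge v (homCoord a) * wedge u (homCoord b))) by ring,
    show 2 * (D * wedge (homCoord a) (homCoord b)) =
      D * (2 * wedge (homCoord a) (homCoord b)) by ring, mul_div_mul_left _ _ this, mul_div_assoc]

/-- Each point enters two of the three factors of `orient`, so rescaling its coordinates costs a
square. The three area forms together contribute the cube of the determinant, which has the sign of
the determinant. -/
theorem orient_smul (g : GL (Fin 2) ℝ) (a b c : OnePoint ℝ) :
    ∃ k : ℝ, 0 < k ∧
      (g 0 0 * g 1 1 - g 0 1 * g 1 0) * orient a b c = k * orient (g • a) (g • b) (g • c) := by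
  obtain ⟨x, hx, e⟩ := exists_planeAct_homCoord g a
  obtain ⟨y, hy, e'⟩ := exists_planeAct_homCoord g b
  obtain ⟨z, hz, e''⟩ := exists_planeAct_homCoord g c
  have h1 := wedge_planeAct g (homCoord a) (homCoord b)
  have h2 := wedge_planeAct g (homCoord b) (homCoord c)
  have h3 := wedge_planeAct g (homCoord a) (homCoord c)
  have hD := det_entries_ne_zero g
  set D := g 0 0 * g 1 1 - g 0 1 * g 1 0
  rw [e, e', wedge_smul_left, wedge_smul_right] at h1
  rw [e', e'', wedge_smul_left, wedge_smul_right] at h2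
  rw [e, e'', wedge_smul_left, wedge_smul_right] at h3
  refine ⟨x ^ 2 * y ^ 2 * z ^ 2 / D ^ 2, by positivity, ?_⟩
  rw [div_mul_eq_mul_div, eq_div_iff (by positivity)]
  calc D * orient a b c * D ^ 2 =
      (D * wedge (homCoord a) (homCoord b)) * (D * wedge (homCoord b) (homCoord c)) *
        (D * wedge (homCoord a) (homCoord c)) := by rw [orient]; ring
    _ = _ := by rw [← h1, ← h2, ← h3, orient]; ring

/-- A map of positive determinant preserves the sides. One of negative determinant reverses every
side, and the resulting sign of `pairForm` cancels that of the determinant, whence the absolute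
value. -/
theorem polygonForm_image (g : GL (Fin 2) ℝ) {S : Set (OnePoint ℝ)} (hS : S.Finite) (u v : ℝ × ℝ) :
    polygonForm ((g • ·) '' S) (planeAct g u) (planeAct g v) =
      |g 0 0 * g 1 1 - g 0 1 * g 1 0| * polygonForm S u v := by
  have hinj : Function.Injective (fun w : OnePoint ℝ => g • w) := MulAction.injective g
  have key : ∀ D : ℝ, D = g 0 0 * g 1 1 - g 0 1 * g 1 0 →
      ∀ a b c, (orient (g • a) (g • c) (g • b) ≤ 0 ↔ D * orient a c b ≤ 0) := by
    rintro D rfl a b c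
    obtain ⟨k, hk, e⟩ := orient_smul g a c b
    rw [e]
    exact ⟨fun h => mul_nonpos_of_nonneg_of_nonpos hk.le h, (nonpos_of_mul_nonpos_right · hk)⟩
  have hiff : ∀ a b, IsNext ((g • ·) '' S) (g • a) (g • b) ↔
      a ∈ S ∧ b ∈ S ∧ a ≠ b ∧ ∀ c ∈ S, orient (g • a) (g • c) (g • b) ≤ 0 := by
    intro a b
    simp only [IsNext, hinj.mem_set_image, Set.forall_mem_image, ne_eq, hinj.eq_iff]
  rcases lt_or_gt_of_ne (det_entries_ne_zero g) with hD | hD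
  · have hset : {p : OnePoint ℝ × OnePoint ℝ | IsNext ((g • ·) '' S) p.1 p.2} =
        (fun p : OnePoint ℝ × OnePoint ℝ => (g • p.2, g • p.1)) ''
          {p : OnePoint ℝ × OnePoint ℝ | IsNext S p.1 p.2} := by
      have hiff' : ∀ a b, IsNext ((g • ·) '' S) (g • a) (g • b) ↔ IsNext S b a := by
        intro a b
        rw [hiff]
        constructor
        · rintro ⟨ha, hb, hab, h⟩
          refine ⟨hb, ha, hab.symm, fun c hc => ?_⟩
          have := (key _ rfl a b c).mp (h c hc)
          have e : orient b c a = -orient a c b := by simp [orient, wedge]; ring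
          rw [e]
          nlinarith
        · rintro ⟨hb, ha, hab, h⟩
          refine ⟨ha, hb, hab.symm, fun c hc => (key _ rfl a b c).mpr ?_⟩
          have e : orient b c a = -orient a c b := by simp [orient, wedge]; ring
          have := h c hc
          rw [e] at this
          nlinarith
      ext ⟨a, b⟩
      constructor
      · intro h
        obtain ⟨a, ha, rfl⟩ := h.1
        obtain ⟨b, hb, rfl⟩ := h.2.1
        exact ⟨(b, a), (hiff' a b).mp h, rfl⟩
      · rintro ⟨⟨b', a'⟩, h, e⟩
        obtain ⟨rfl, rfl⟩ := Prod.mk.inj e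
        exact (hiff' _ _).mpr h
    rw [polygonForm, hset, finsum_mem_image, abs_of_neg hD, polygonForm,
      ← smul_eq_mul, smul_finsum_mem (finite_isNext hS)]
    · refine finsum_mem_congr rfl fun p _ => ?_
      rw [pairForm_planeAct, pairForm_swap, smul_eq_mul]
      ring
    · rintro ⟨a, b⟩ - ⟨a', b'⟩ - h
      obtain ⟨h1, h2⟩ := Prod.mk.inj h
      exact Prod.ext (hinj h2) (hinj h1)
  · have hset : {p : OnePoint ℝ × OnePoint ℝ | IsNext ((g • ·) '' S) p.1 p.2} =
        (fun p : OnePoint ℝ × OnePoint ℝ => (g • p.1, g • p.2)) ''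
          {p : OnePoint ℝ × OnePoint ℝ | IsNext S p.1 p.2} := by
      have hiff' : ∀ a b, IsNext ((g • ·) '' S) (g • a) (g • b) ↔ IsNext S a b := by
        intro a b
        rw [hiff]
        refine and_congr_right fun _ => and_congr_right fun _ => and_congr_right fun _ =>
          forall_congr' fun c => forall_congr' fun _ => ?_
        rw [key _ rfl]
        exact ⟨(nonpos_of_mul_nonpos_right · hD), fun h => mul_nonpos_of_nonneg_of_nonpos hD.le h⟩
      ext ⟨a, b⟩
      constructor
      · intro h
        obtain ⟨a, ha, rfl⟩ := h.1
        obtain ⟨b, hb, rfl⟩ := h.2.1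
        exact ⟨(a, b), (hiff' a b).mp h, rfl⟩
      · rintro ⟨⟨a', b'⟩, h, e⟩
        obtain ⟨rfl, rfl⟩ := Prod.mk.inj e
        exact (hiff' _ _).mpr h
    rw [polygonForm, hset, finsum_mem_image, abs_of_pos hD, polygonForm,
      ← smul_eq_mul, smul_finsum_mem (finite_isNext hS)]
    · refine finsum_mem_congr rfl fun p _ => ?_
      rw [pairForm_planeAct, smul_eq_mul]
    · rintro ⟨a, b⟩ - ⟨a', b'⟩ - h
      obtain ⟨h1, h2⟩ := Prod.mk.inj h
      exact Prod.ext (hinj h1) (hinj h2)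

/-! ### Positivity of the polygon form. -/

theorem orient_coe (a b c : ℝ) : orient a b c = (b - a) * (c - b) * (c - a) := by
  simp [orient, wedge]

theorem orient_coe_infty_coe (a b : ℝ) : orient a OnePoint.infty b = a - b := by
  simp [orient, wedge]

theorem pairForm_one_zero_coe (a b : ℝ) :
    pairForm (1, 0) (1, 0) (homCoord a) (homCoord b) = 1 / (b - a) := by
  simp [pairForm, wedge]
  rw [show (1 : ℝ) + 1 = 2 by norm_num]
  by_cases h : b - a = 0
  · simp [h]
  · field_simp

/-- At `(1, 0)` a finite side from `a` to `b` contributes `1 / (b - a)` and a side ending at `∞`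
contributes nothing. The only possible negative term is the closing side from the maximum `M` to the
minimum `m`. It is outweighed by the side from `m` to the second smallest point `m'`, since three
finite points force `m' < M`. -/
theorem polygonForm_one_zero_pos {S : Set (OnePoint ℝ)} (hS : S.Finite) (h3 : 3 ≤ S.ncard) :
    0 < polygonForm S (1, 0) (1, 0) := by
  classical
  set T : Set ℝ := (fun x : ℝ => (x : OnePoint ℝ)) ⁻¹' S with hTdef
  have hTfin : T.Finite := hS.preimage OnePoint.coe_injective.injOn
  set F := hTfin.toFinset with hF
  have hmemF : ∀ x : ℝ, x ∈ F ↔ (x : OnePoint ℝ) ∈ S := fun x => by simp [hF, hTdef]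
  have hST : S \ {OnePoint.infty} = (fun x : ℝ => (x : OnePoint ℝ)) '' T := by
    ext w
    induction w using OnePoint.rec <;> simp [hTdef]
  have hcardT : (S \ {OnePoint.infty}).ncard = F.card := by
    rw [hST, Set.ncard_image_of_injective _ OnePoint.coe_injective, Set.ncard_eq_toFinset_card _ hTfin]
  have hF2 : 2 ≤ F.card := by
    have := Set.le_ncard_sdiff {OnePoint.infty} S (Set.finite_singleton _)
    rw [Set.ncard_singleton] at this
    omega
  have hne : F.Nonempty := Finset.card_pos.mp (by omega)
  set m := F.min' hne with hm
  have hmF : m ∈ F := F.min'_mem hne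
  have hne' : (F.erase m).Nonempty := Finset.card_pos.mp (by
    rw [Finset.card_erase_of_mem hmF]; omega)
  set m' := (F.erase m).min' hne' with hm'
  have hm'F : m' ∈ F.erase m := Finset.min'_mem _ hne'
  have hmm' : m < m' := lt_of_le_of_ne (F.min'_le _ (Finset.mem_of_mem_erase hm'F))
    (Finset.ne_of_mem_erase hm'F).symm
  have hm'min : ∀ x ∈ F, x ≠ m → m' ≤ x := fun x hx hxm =>
    Finset.min'_le _ _ (Finset.mem_erase.mpr ⟨hxm, hx⟩)
  have hnext : IsNext S m m' := by
    refine ⟨(hmemF _).mp hmF, (hmemF _).mp (Finset.mem_of_mem_erase hm'F), ?_, ?_⟩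
    · rw [ne_eq, OnePoint.coe_eq_coe]; exact hmm'.ne
    · intro c hc
      induction c using OnePoint.rec with
      | infty => rw [orient_coe_infty_coe]; linarith
      | coe c =>
        rw [orient_coe]
        rcases eq_or_ne c m with rfl | hcm
        · simp
        · have h1 := hm'min c ((hmemF c).mpr hc) hcm
          have : (c - m) * (m' - c) ≤ 0 := mul_nonpos_of_nonneg_of_nonpos (by linarith) (by linarith)
          exact mul_nonpos_of_nonpos_of_nonneg this (by linarith)
  have hinfty : ∀ a b, a = OnePoint.infty ∨ b = OnePoint.infty →
      pairForm (1, 0) (1, 0) (homCoord a) (homCoord b) = 0 := by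
    rintro a b (rfl | rfl) <;> simp [pairForm, wedge]
  -- A descending side passes over `∞` and leaves no vertex outside `[b, a]`.
  have hwrap : ∀ a b : ℝ, IsNext S a b → b < a →
      OnePoint.infty ∉ S ∧ b = m ∧ a = F.max' hne := by
    rintro a b ⟨ha, hb, hab, h⟩ hlt
    have hcm : ∀ c ∈ F, b ≤ c ∧ c ≤ a := by
      intro c hc
      have := h c ((hmemF c).mp hc)
      rw [orient_coe] at this
      constructor
      · by_contra! hcb
        have : 0 < (c - a) * (b - c) * (b - a) :=
          mul_pos_of_neg_of_neg (mul_neg_of_neg_of_pos (by linarith) (by linarith)) (by linarith)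
        linarith
      · by_contra! hcb
        have : 0 < (c - a) * (b - c) * (b - a) :=
          mul_pos_of_neg_of_neg (mul_neg_of_pos_of_neg (by linarith) (by linarith)) (by linarith)
        linarith
    refine ⟨fun hinf => ?_, ?_, ?_⟩
    · have := h _ hinf
      rw [orient_coe_infty_coe] at this
      linarith
    · exact le_antisymm (Finset.le_min' _ _ _ fun c hc => (hcm c hc).1)
        (Finset.min'_le _ _ ((hmemF b).mpr hb))
    · exact le_antisymm (Finset.le_max' _ _ ((hmemF a).mpr ha))
        (Finset.max'_le _ _ _ fun c hc => (hcm c hc).2)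
  have hnonneg : ∀ p : OnePoint ℝ × OnePoint ℝ, IsNext S p.1 p.2 →
      (OnePoint.infty ∈ S ∨ p ≠ (((F.max' hne : ℝ) : OnePoint ℝ), ((m : ℝ) : OnePoint ℝ))) →
      0 ≤ pairForm (1, 0) (1, 0) (homCoord p.1) (homCoord p.2) := by
    rintro ⟨a, b⟩ hp hor
    induction a using OnePoint.rec with
    | infty => rw [hinfty _ _ (Or.inl rfl)]
    | coe a =>
      induction b using OnePoint.rec with
      | infty => rw [hinfty _ _ (Or.inr rfl)]
      | coe b =>
        rw [pairForm_one_zero_coe]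
        rcases le_or_gt a b with h | h
        · exact one_div_nonneg.mpr (by linarith)
        · obtain ⟨h1, rfl, rfl⟩ := hwrap a b hp h
          rcases hor with h2 | h2
          · exact absurd h2 h1
          · exact absurd rfl h2
  have hpos : 0 < pairForm (1, 0) (1, 0) (homCoord m) (homCoord m') := by
    rw [pairForm_one_zero_coe]
    exact one_div_pos.mpr (by linarith)
  rw [polygonForm_eq_sum hS]
  by_cases hinf : OnePoint.infty ∈ S
  -- With `∞` a vertex no side is negative, and the side from `m` to `m'` is enough; here only two
  -- finite vertices are guaranteed.
  · refine Finset.sum_pos' (fun p hp => ?_) ⟨((m : ℝ), (m' : ℝ)), ?_, hpos⟩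
    · exact hnonneg p ((finite_isNext hS).mem_toFinset.mp hp) (Or.inl hinf)
    · exact (Set.Finite.mem_toFinset _).mpr hnext
  · have hF3 : 3 ≤ F.card := by
      rw [← hcardT, Set.sdiff_singleton_eq_self hinf]; exact h3
    set M := F.max' hne with hM
    have hMF : M ∈ F := F.max'_mem hne
    have hm'M : m' < M := by
      refine lt_of_le_of_ne (F.le_max' _ (Finset.mem_of_mem_erase hm'F)) fun e => ?_
      have : F ⊆ {m, m'} := by
        intro x hx
        rcases eq_or_ne x m with rfl | hxm
        · simp
        · have h1 := hm'min x hx hxm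
          have h2 := F.le_max' x hx
          rw [← hM, ← e] at h2
          simp [le_antisymm h2 h1]
      have := Finset.card_le_card this
      have := Finset.card_le_two (a := m) (b := m')
      omega
    have hnextM : IsNext S M m := by
      refine ⟨(hmemF _).mp hMF, (hmemF _).mp hmF, ?_, ?_⟩
      · rw [ne_eq, OnePoint.coe_eq_coe]; exact (hmm'.trans hm'M).ne'
      · intro c hc
        induction c using OnePoint.rec with
        | infty => exact absurd hc hinf
        | coe c =>
          rw [orient_coe]
          have h1 := F.min'_le c ((hmemF c).mpr hc)
          have h2 := F.le_max' c ((hmemF c).mpr hc)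
          have : 0 ≤ (c - M) * (m - c) := mul_nonneg_of_nonpos_of_nonpos (by linarith) (by linarith)
          exact mul_nonpos_of_nonneg_of_nonpos this (by linarith)
    have hsub : {((M : OnePoint ℝ), (m : OnePoint ℝ)), ((m : OnePoint ℝ), (m' : OnePoint ℝ))} ⊆
        (finite_isNext hS).toFinset := by
      intro p hp
      rw [Set.Finite.mem_toFinset]
      rcases Finset.mem_insert.mp hp with rfl | hp
      · exact hnextM
      · rw [Finset.mem_singleton.mp hp]; exact hnext
    refine lt_of_lt_of_le ?_ (Finset.sum_le_sum_of_subset_of_nonneg hsub fun p hp hp' =>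
      hnonneg p ((finite_isNext hS).mem_toFinset.mp hp) (Or.inr fun e => hp' (by simp [e])))
    rw [Finset.sum_pair]
    · rw [pairForm_one_zero_coe, pairForm_one_zero_coe]
      have : 1 / (M - m) < 1 / (m' - m) := one_div_lt_one_div_of_lt (by linarith) (by linarith)
      rw [show m - M = -(M - m) by ring, div_neg]
      linarith
    · intro e
      have := OnePoint.coe_injective (Prod.mk.inj e).1
      linarith

/-- A rotation with scaling carries `(1, 0)` to `v`, so by equivariance it suffices to test the
single vector `(1, 0)` on all finite sets with at least three points. -/
theorem polygonForm_self_pos {S : Set (OnePoint ℝ)} (hS : S.Finite) (h3 : 3 ≤ S.ncard)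
    {v : ℝ × ℝ} (hv : v ≠ 0) : 0 < polygonForm S v v := by
  have hD : 0 < v.1 * v.1 + v.2 * v.2 := by
    rcases eq_or_ne v.1 0 with h | h
    · have h2 : v.2 ≠ 0 := fun h' => hv (Prod.ext h h')
      have := mul_self_pos.mpr h2
      nlinarith
    · have := mul_self_pos.mpr h
      nlinarith
  let g : GL (Fin 2) ℝ := Matrix.GeneralLinearGroup.mkOfDetNeZero !![v.1, -v.2; v.2, v.1] (by
    rw [Matrix.det_fin_two_of]; nlinarith)
  have hv' : planeAct g (1, 0) = v := by
    simp [planeAct, g, Matrix.GeneralLinearGroup.mkOfDetNeZero]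
  have hS' : (g • ·) '' ((g⁻¹ • ·) '' S) = S := by
    rw [Set.image_image]; simp
  have := polygonForm_image g (hS.image (g⁻¹ • ·)) (1, 0) (1, 0)
  rw [hS', hv'] at this
  rw [this]
  refine mul_pos (abs_pos.mpr (det_entries_ne_zero g)) (polygonForm_one_zero_pos (hS.image _) ?_)
  rwa [Set.ncard_image_of_injective _ (MulAction.injective g⁻¹)]

/-! ### Cyclically ordered families -/

/-- The sum of the normalized forms attached to consecutive members of a cyclic family. -/
noncomputable def cyclicForm {k : ℕ} (a : Fin k → ℝ × ℝ) (u v : ℝ × ℝ) : ℝ :=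
  ∑ i, pairForm u v (a i) (a (finRotate k i))

/-- When the numbering follows the positive cyclic order, the successor of a vertex has the next
index modulo the length. Having at least two indices ensures that `finRotate` moves every index. -/
theorem isNext_range_iff {k : ℕ} {w : Fin (k + 2) → OnePoint ℝ} (hinj : Function.Injective w)
    (hw : ∀ i j m, i < j → j < m → 0 < orient (w i) (w j) (w m)) (i j : Fin (k + 2)) :
    IsNext (Set.range w) (w i) (w j) ↔ j = finRotate (k + 2) i := by
  have hrot : ∀ i : Fin (k + 2), (i.val < k + 1 ∧ (finRotate (k + 2) i).val = i.val + 1) ∨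
      (i.val = k + 1 ∧ (finRotate (k + 2) i).val = 0) := by
    intro i
    rcases eq_or_ne i (Fin.last (k + 1)) with rfl | h
    · right; simp
    · left
      exact ⟨Fin.val_lt_last h, coe_finRotate_of_ne_last h⟩
  constructor
  · rintro ⟨-, -, hij, h⟩
    have hij : i ≠ j := fun e => hij (congrArg w e)
    have h' : ∀ m, orient (w i) (w m) (w j) ≤ 0 := fun m => h _ ⟨m, rfl⟩
    apply Fin.ext
    rcases lt_or_gt_of_ne hij with hlt | hlt
    · rcases hrot i with ⟨h1, h2⟩ | ⟨h1, h2⟩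
      · by_contra hne
        have h3 := hw i ⟨i.val + 1, by omega⟩ j (by rw [Fin.lt_def]; simp)
          (by rw [Fin.lt_def] at hlt ⊢; simp; omega)
        exact absurd h3 (not_lt.mpr (h' _))
      · have := j.isLt; rw [Fin.lt_def] at hlt; omega
    -- A descending side must close the cycle: otherwise the first vertex or, below, the last one
    -- would lie strictly between its ends in the cyclic order.
    · have hj : j.val = 0 := by
        by_contra hne
        have h3 := hw ⟨0, by omega⟩ j i (by rw [Fin.lt_def]; exact Nat.pos_of_ne_zero hne) hlt
        have h4 := h' ⟨0, by omega⟩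
        rw [orient_swap_left, orient_swap_right] at h4
        linarith
      rcases hrot i with ⟨h1, h2⟩ | ⟨h1, h2⟩
      · have h3 := hw j i (Fin.last (k + 1)) hlt (by rw [Fin.lt_def]; simpa using h1)
        have h4 := h' (Fin.last (k + 1))
        rw [orient_swap_right, orient_swap_left] at h4
        linarith
      · omega
  · rintro rfl
    set j := finRotate (k + 2) i with hj
    have hval := hrot i
    rw [← hj] at hval
    have hij : i ≠ j := by
      intro e
      rw [← e] at hval
      omega
    refine ⟨⟨i, rfl⟩, ⟨j, rfl⟩, fun e => hij (hinj e), ?_⟩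
    rintro _ ⟨m, rfl⟩
    rcases eq_or_ne m i with rfl | hmi
    · exact le_of_eq (by simp only [orient, wedge]; ring)
    rcases eq_or_ne m j with rfl | hmj
    · exact le_of_eq (by simp only [orient, wedge]; ring)
    have hmi' : m.val ≠ i.val := fun e => hmi (Fin.ext e)
    have hmj' : m.val ≠ j.val := fun e => hmj (Fin.ext e)
    rcases hval with ⟨h1, h2⟩ | ⟨h1, h2⟩
    · rcases lt_or_gt_of_ne hmi with hlt | hlt
      · have := hw m i j hlt (by rw [Fin.lt_def]; omega)
        rw [orient_swap_left]
        linarith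
      · have := hw i j m (by rw [Fin.lt_def]; omega) (by rw [Fin.lt_def] at hlt ⊢; omega)
        rw [orient_swap_right]
        linarith
    · have := hw j m i (by rw [Fin.lt_def]; omega) (by rw [Fin.lt_def]; have := m.isLt; omega)
      rw [orient_swap_right, orient_swap_left, orient_swap_right]
      linarith

theorem polygonForm_range {k : ℕ} {w : Fin (k + 2) → OnePoint ℝ} (hinj : Function.Injective w)
    (hw : ∀ i j m, i < j → j < m → 0 < orient (w i) (w j) (w m)) (u v : ℝ × ℝ) :
    polygonForm (Set.range w) u v = cyclicForm (fun i => homCoord (w i)) u v := by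
  have hset : {p : OnePoint ℝ × OnePoint ℝ | IsNext (Set.range w) p.1 p.2} =
      Set.range fun i => (w i, w (finRotate (k + 2) i)) := by
    ext ⟨a, b⟩
    constructor
    · intro h
      obtain ⟨i, rfl⟩ := h.1
      obtain ⟨j, rfl⟩ := h.2.1
      rw [(isNext_range_iff hinj hw i j).mp h]
      exact ⟨i, rfl⟩
    · rintro ⟨i, e⟩
      obtain ⟨rfl, rfl⟩ := Prod.mk.inj e
      exact (isNext_range_iff hinj hw _ _).mpr rfl
  rw [polygonForm, hset, finsum_mem_range, finsum_eq_sum_of_fintype, cyclicForm]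
  intro i j h
  exact hinj (Prod.mk.inj h).1

/-! ### The angle of a positive definite binary form -/

/-- The angle between two vectors with Gram matrix `(P, Q; Q, R)`. -/
noncomputable def gramAngle (P Q R : ℝ) : ℝ := Real.arccos (Q / Real.sqrt (P * R))

theorem gramAngle_smul {c : ℝ} (hc : 0 < c) (P Q R : ℝ) :
    gramAngle (c * P) (c * Q) (c * R) = gramAngle P Q R := by
  rw [gramAngle, gramAngle, show c * P * (c * R) = c ^ 2 * (P * R) by ring,
    Real.sqrt_mul (sq_nonneg c), Real.sqrt_sq hc.le, mul_div_mul_left _ _ hc.ne']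

theorem gramAngle_scale {c d : ℝ} (hc : 0 < c) (hd : 0 < d) (P Q R : ℝ) :
    gramAngle (c * c * P) (c * d * Q) (d * d * R) = gramAngle P Q R := by
  rw [gramAngle, gramAngle, show c * c * P * (d * d * R) = (c * d) ^ 2 * (P * R) by ring,
    Real.sqrt_mul (sq_nonneg _), Real.sqrt_sq (by positivity), mul_div_mul_left _ _ (by positivity)]

theorem gramAngle_swap (P Q R : ℝ) : gramAngle R Q P = gramAngle P Q R := by
  rw [gramAngle, gramAngle, mul_comm]

theorem gramAngle_neg (P Q R : ℝ) : gramAngle P (-Q) R = Real.pi - gramAngle P Q R := by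
  rw [gramAngle, gramAngle, neg_div, Real.arccos_neg]

theorem abs_div_sqrt_lt_one {P Q R : ℝ} (h : Q ^ 2 < P * R) :
    |Q / Real.sqrt (P * R)| < 1 := by
  have h0 : 0 < Real.sqrt (P * R) := Real.sqrt_pos.mpr ((sq_nonneg Q).trans_lt h)
  rw [abs_div, abs_of_pos h0, div_lt_one h0, ← Real.sqrt_sq_eq_abs]
  exact Real.sqrt_lt_sqrt (sq_nonneg _) h

theorem gramAngle_pos {P Q R : ℝ} (h : Q ^ 2 < P * R) : 0 < gramAngle P Q R :=
  Real.arccos_pos.mpr (abs_lt.mp (abs_div_sqrt_lt_one h)).2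

theorem gramAngle_lt_pi {P Q R : ℝ} (h : Q ^ 2 < P * R) : gramAngle P Q R < Real.pi := by
  refine lt_of_le_of_ne (Real.arccos_le_pi _) fun e => ?_
  have := (abs_lt.mp (abs_div_sqrt_lt_one h)).1
  have := Real.arccos_eq_pi.mp e
  linarith

/-- Place the second vector on the positive real axis of `ℂ`; up to a positive factor the first is
then `Q + i√(PR - Q²)`, of norm `√(PR)`. Angles of binary forms thus become arguments, and
`arg_div_add_arg` applies. -/
theorem gramAngle_eq_arg {P Q R : ℝ} (h : Q ^ 2 < P * R) :
    gramAngle P Q R = (⟨Q, Real.sqrt (P * R - Q ^ 2)⟩ : ℂ).arg := by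
  have hΔ : 0 < Real.sqrt (P * R - Q ^ 2) := Real.sqrt_pos.mpr (by linarith)
  rw [Complex.arg_of_im_nonneg_of_ne_zero hΔ.le, gramAngle, Complex.norm_def, Complex.normSq_mk,
    Real.mul_self_sqrt (by linarith)]
  · congr 4
    ring
  · intro e
    exact hΔ.ne' (congrArg Complex.im e)

/-- The intermediate vector is `p` times the first plus `q` times the second, with squared norm `N`.
The Gram determinants of the two partial pairs are `q²` and `p²` times the original one. -/
theorem gramAngle_add {P Q R : ℝ} (hP : 0 < P) (hR : 0 < R) (h : Q ^ 2 < P * R) {p q : ℝ}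
    (hp : 0 < p) (hq : 0 < q) :
    gramAngle P (p * P + q * Q) (p ^ 2 * P + 2 * p * q * Q + q ^ 2 * R) +
      gramAngle (p ^ 2 * P + 2 * p * q * Q + q ^ 2 * R) (p * Q + q * R) R = gramAngle P Q R := by
  set N := p ^ 2 * P + 2 * p * q * Q + q ^ 2 * R with hN
  have hd1 : P * N - (p * P + q * Q) ^ 2 = q ^ 2 * (P * R - Q ^ 2) := by rw [hN]; ring
  have hd2 : N * R - (p * Q + q * R) ^ 2 = p ^ 2 * (P * R - Q ^ 2) := by rw [hN]; ring
  have hdet : 0 < P * R - Q ^ 2 := by linarith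
  have h1 : (p * P + q * Q) ^ 2 < P * N := by
    have : 0 < q ^ 2 * (P * R - Q ^ 2) := by positivity
    linarith
  have h2 : (p * Q + q * R) ^ 2 < N * R := by
    have : 0 < p ^ 2 * (P * R - Q ^ 2) := by positivity
    linarith
  have hNpos : 0 < N := by
    have := (sq_nonneg _).trans_lt h1
    exact (mul_pos_iff_of_pos_left hP).mp this
  rw [gramAngle_eq_arg h, gramAngle_eq_arg h1, gramAngle_eq_arg h2, hd1, hd2,
    Real.sqrt_mul (sq_nonneg _), Real.sqrt_mul (sq_nonneg _), Real.sqrt_sq hp.le,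
    Real.sqrt_sq hq.le]
  have hΔ : 0 < Real.sqrt (P * R - Q ^ 2) := Real.sqrt_pos.mpr hdet
  have hΔ2 : Real.sqrt (P * R - Q ^ 2) ^ 2 = P * R - Q ^ 2 := Real.sq_sqrt hdet.le
  set Δ := Real.sqrt (P * R - Q ^ 2)
  -- The first vector in the scale where the second is `1`. The three angles are the arguments of
  -- `τ`, `pτ + q` and their quotient, up to positive factors.
  let τ : ℂ := ⟨Q / R, Δ / R⟩
  have hτ : 0 < τ.im := by positivity
  have e0 : (⟨Q, Δ⟩ : ℂ) = (R : ℂ) * τ := by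
    apply Complex.ext <;> simp [τ] <;> field_simp
  have e2 : (⟨p * Q + q * R, p * Δ⟩ : ℂ) = (R : ℂ) * (p * τ + q) := by
    apply Complex.ext <;> simp [τ] <;> field_simp
  have hne : (p * τ + q : ℂ) ≠ 0 := by
    intro e
    have := congrArg Complex.im e
    simp at this
    rcases this with h | h
    · exact hp.ne' h
    · exact hτ.ne' h
  have e1 : (⟨p * P + q * Q, q * Δ⟩ : ℂ) = (N : ℂ) * (τ / (p * τ + q)) := by
    rw [mul_div_assoc', eq_div_iff hne]
    apply Complex.ext
    · simp [τ]
      field_simp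
      rw [hN]
      linear_combination (-p * q) * hΔ2
    · simp [τ]
      field_simp
      rw [hN]
      ring
  rw [e0, e1, e2, Complex.arg_real_mul _ hR, Complex.arg_real_mul _ hR,
    Complex.arg_real_mul _ hNpos]
  exact arg_div_add_arg hτ hp hq

/-! ### Pencils with real generalized eigenvalues -/

/-- The real or infinite generalized eigenvalues of the pencil. -/
def realSpectrum {n : ℕ} (A B : Mat n) : Set (OnePoint ℝ) :=
  {w | pencilForm A B (homCoord w).2 (-(homCoord w).1) = 0}

theorem coe_mem_realSpectrum {n : ℕ} {A B : Mat n} {x : ℝ} :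
    (x : OnePoint ℝ) ∈ realSpectrum A B ↔ pencilDet A B x = 0 := by
  simp [realSpectrum, pencilDet_eq_pencilForm]

theorem infty_mem_realSpectrum {n : ℕ} {A B : Mat n} :
    OnePoint.infty ∈ realSpectrum A B ↔ B.det = 0 := by
  have hd : (B.map Complex.ofReal).det = (B.det : ℂ) := (RingHom.map_det Complex.ofRealHom B).symm
  have : pencilForm A B 0 (-1) = (-1) ^ n * (B.det : ℂ) := by
    rw [← hd, pencilForm, zero_smul, zero_add, det_smul, Fintype.card_fin]
  simp [realSpectrum, this]

theorem finite_realSpectrum {n : ℕ} {A B : Mat n} (h : IsRegularPencil A B) :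
    (realSpectrum A B).Finite := by
  have hf : {x : ℝ | pencilDet A B x = 0}.Finite :=
    (finite_pencilDet_eq_zero h).preimage Complex.ofReal_injective.injOn
  refine ((hf.image (fun x : ℝ => (x : OnePoint ℝ))).insert OnePoint.infty).subset fun w hw => ?_
  induction w using OnePoint.rec with
  | infty => exact Set.mem_insert _ _
  | coe x => exact Set.mem_insert_of_mem _ ⟨x, coe_mem_realSpectrum.mp hw, rfl⟩

/-- Replaces the Gram entries by plain real variables, so that base changes become polynomial
identities. -/
theorem exists_polygonForm_expand {S : Set (OnePoint ℝ)} (hS : S.Finite) :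
    ∃ P Q R : ℝ, polygonForm S (0, 1) (0, 1) = P ∧ polygonForm S (0, 1) (-1, 0) = Q ∧
      polygonForm S (-1, 0) (-1, 0) = R ∧ ∀ x y x' y', polygonForm S (-y, x) (-y', x') =
        x * x' * P + (x * y' + x' * y) * Q + y * y' * R :=
  ⟨_, _, _, rfl, rfl, rfl, polygonForm_expand hS⟩

/-- The Möbius transformation relating the spectra of two bases of a pencil. -/
noncomputable def pencilAct {a b c d : ℝ} (had : a * d - b * c ≠ 0) : GL (Fin 2) ℝ :=
  Matrix.GeneralLinearGroup.mkOfDetNeZero !![d, -b; -c, a] (by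
    rw [Matrix.det_fin_two_of]; intro h; apply had; linarith)

theorem planeAct_pencilAct {a b c d : ℝ} (had : a * d - b * c ≠ 0) (v : ℝ × ℝ) :
    planeAct (pencilAct had) v = (d * v.1 - b * v.2, -(c * v.1) + a * v.2) := by
  simp [planeAct, pencilAct, Matrix.GeneralLinearGroup.mkOfDetNeZero]
  ring

/-- The member with coordinates `v` in the new basis has coordinates `planeAct (pencilAct had) v` in
the old one. The action therefore leads from the new spectrum to the old. -/
theorem mem_realSpectrum_comb {n : ℕ} (A B : Mat n) {a b c d : ℝ} (had : a * d - b * c ≠ 0)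
    (w : OnePoint ℝ) : w ∈ realSpectrum (a • A + b • B) (c • A + d • B) ↔
      pencilAct had • w ∈ realSpectrum A B := by
  obtain ⟨k, hk, e⟩ := exists_planeAct_homCoord (pencilAct had) w
  rw [planeAct_pencilAct] at e
  have e1 := congrArg Prod.fst e
  have e2 := congrArg Prod.snd e
  simp only [Prod.smul_fst, Prod.smul_snd, smul_eq_mul] at e1 e2
  simp only [realSpectrum, Set.mem_ofPred_eq]
  have h1 : ((homCoord w).2 * a + -(homCoord w).1 * c : ℂ) =
      k * (homCoord (pencilAct had • w)).2 := by
    have := congrArg Complex.ofReal e2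
    push_cast at this
    linear_combination this
  have h2 : ((homCoord w).2 * b + -(homCoord w).1 * d : ℂ) =
      k * -(homCoord (pencilAct had • w)).1 := by
    have := congrArg Complex.ofReal e1
    push_cast at this
    linear_combination -this
  rw [pencilForm_comb, h1, h2, pencilForm_smul, mul_eq_zero,
    or_iff_right (pow_ne_zero _ (Complex.ofReal_ne_zero.mpr hk))]

theorem realSpectrum_eq_image {n : ℕ} (A B : Mat n) {a b c d : ℝ} (had : a * d - b * c ≠ 0) :
    realSpectrum A B =
      (pencilAct had • ·) '' realSpectrum (a • A + b • B) (c • A + d • B) := by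
  ext w
  constructor
  · intro hw
    refine ⟨(pencilAct had)⁻¹ • w, ?_, smul_inv_smul _ _⟩
    rw [mem_realSpectrum_comb A B had, smul_inv_smul]
    exact hw
  · rintro ⟨v, hv, rfl⟩
    exact (mem_realSpectrum_comb A B had v).mp hv

theorem realSpectrum_conj {n : ℕ} (A B : Mat n) {h : Mat n} (hh : h.det ≠ 0) :
    realSpectrum (h * A * hᵀ) (h * B * hᵀ) = realSpectrum A B := by
  ext w
  simp only [realSpectrum, Set.mem_ofPred_eq]
  rw [pencilForm_conj, mul_eq_zero, or_iff_right (pow_ne_zero _ (Complex.ofReal_ne_zero.mpr hh))]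

/-- The inclusion `ℝ ∪ {∞} ⊆ ℂ ∪ {∞}`. -/
noncomputable def extendedOfReal : OnePoint ℝ → OnePoint ℂ := OnePoint.map Complex.ofReal

@[simp] theorem extendedOfReal_infty : extendedOfReal OnePoint.infty = OnePoint.infty := rfl

@[simp] theorem extendedOfReal_coe (x : ℝ) : extendedOfReal x = realPoint x := rfl

theorem extendedOfReal_injective : Function.Injective extendedOfReal :=
  Option.map_injective Complex.ofReal_injective

theorem extendedOfReal_mem_genEigenvalues {n : ℕ} {A B : Mat n} {w : OnePoint ℝ} :
    extendedOfReal w ∈ genEigenvalues A B ↔ w ∈ realSpectrum A B := by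
  induction w using OnePoint.rec with
  | infty => rw [infty_mem_realSpectrum, extendedOfReal_infty, infty_mem_genEigenvalues]
  | coe x => rw [coe_mem_realSpectrum, extendedOfReal_coe, realPoint, coe_mem_genEigenvalues]

theorem extendedReals_eq_range : extendedReals = Set.range extendedOfReal := by
  ext w
  constructor
  · rintro (rfl | ⟨x, rfl⟩)
    · exact ⟨OnePoint.infty, rfl⟩
    · exact ⟨x, rfl⟩
  · rintro ⟨v, rfl⟩
    induction v using OnePoint.rec with
    | infty => exact Set.mem_insert _ _
    | coe x => exact Set.mem_insert_of_mem _ ⟨x, rfl⟩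

theorem genEigenvalues_eq_image {n : ℕ} {A B : Mat n} (h : genEigenvalues A B ⊆ extendedReals) :
    genEigenvalues A B = extendedOfReal '' realSpectrum A B := by
  ext w
  constructor
  · intro hw
    have := h hw
    rw [extendedReals_eq_range] at this
    obtain ⟨v, rfl⟩ := this
    exact ⟨v, extendedOfReal_mem_genEigenvalues.mp hw, rfl⟩
  · rintro ⟨v, hv, rfl⟩
    exact extendedOfReal_mem_genEigenvalues.mpr hv

theorem isTypeTwo_iff {n : ℕ} {A B : Mat n} :
    IsTypeTwo A B ↔ IsRegularPencil A B ∧ nonrealRoots A B = ∅ ∧ 3 ≤ (realSpectrum A B).ncard := by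
  have h0 : genEigenvalues A B ⊆ extendedReals ↔ nonrealRoots A B = ∅ := by
    rw [genEigenvalues_subset_extendedReals_iff, Set.eq_empty_iff_forall_notMem]
    refine forall_congr' fun z => ?_
    simp only [nonrealRoots, Set.mem_ofPred_eq]
    tauto
  rw [IsTypeTwo]
  refine and_congr_right fun hr => ?_
  rw [← h0]
  refine and_congr_right fun h => ?_
  rw [genEigenvalues_eq_image h, extendedOfReal_injective.encard_image,
    ← (finite_realSpectrum hr).cast_ncard_eq]
  exact_mod_cast Iff.rfl

theorem IsTypeTwo.comb {n : ℕ} {A B : Mat n} (h : IsTypeTwo A B) {a b c d : ℝ}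
    (had : a * d - b * c ≠ 0) : IsTypeTwo (a • A + b • B) (c • A + d • B) := by
  rw [isTypeTwo_iff] at h ⊢
  refine ⟨isRegularPencil_comb h.1 had, ?_, ?_⟩
  · rw [nonrealRoots_comb A B had, h.2.1, Set.image_empty]
  · have := h.2.2
    rwa [realSpectrum_eq_image A B had,
      Set.ncard_image_of_injective _ (MulAction.injective (pencilAct had))] at this

/-- The angle of a pencil measured by the form of the polygon spanned by its spectrum. -/
noncomputable def polygonAngle {n : ℕ} (A B : Mat n) : ℝ :=
  gramAngle (polygonForm (realSpectrum A B) (0, 1) (0, 1))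
    (polygonForm (realSpectrum A B) (0, 1) (-1, 0))
    (polygonForm (realSpectrum A B) (-1, 0) (-1, 0))

/-- Equivariance multiplies the three Gram entries by one positive factor, which the angle does not
see. The new pair is thus measured by the form of the old spectrum. -/
theorem polygonAngle_comb {n : ℕ} {A B : Mat n} (h : IsRegularPencil A B) {a b c d : ℝ}
    (had : a * d - b * c ≠ 0) :
    polygonAngle (a • A + b • B) (c • A + d • B) =
      gramAngle (polygonForm (realSpectrum A B) (-b, a) (-b, a))
        (polygonForm (realSpectrum A B) (-b, a) (-d, c))
        (polygonForm (realSpectrum A B) (-d, c) (-d, c)) := by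
  have hfin := finite_realSpectrum (isRegularPencil_comb h had)
  have e1 : planeAct (pencilAct had) (0, 1) = (-b, a) := by simp [planeAct_pencilAct]
  have e2 : planeAct (pencilAct had) (-1, 0) = (-d, c) := by simp [planeAct_pencilAct]
  rw [realSpectrum_eq_image A B had, ← e1, ← e2, polygonForm_image _ hfin,
    polygonForm_image _ hfin, polygonForm_image _ hfin,
    gramAngle_smul (abs_pos.mpr (det_entries_ne_zero _)), polygonAngle]

theorem polygonForm_gram_pos {S : Set (OnePoint ℝ)} (hS : S.Finite) (h3 : 3 ≤ S.ncard) :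
    0 < polygonForm S (0, 1) (0, 1) ∧ 0 < polygonForm S (-1, 0) (-1, 0) ∧
      polygonForm S (0, 1) (-1, 0) ^ 2 <
        polygonForm S (0, 1) (0, 1) * polygonForm S (-1, 0) (-1, 0) := by
  have hP := polygonForm_self_pos hS h3 (v := (0, 1)) (by simp)
  have hR := polygonForm_self_pos hS h3 (v := (-1, 0)) (by simp)
  refine ⟨hP, hR, ?_⟩
  -- This vector is orthogonal to `(0, 1)` for the form, and the form takes the value `P(PR - Q²)`
  -- on it.
  have h := polygonForm_self_pos hS h3
    (v := (-(-polygonForm S (0, 1) (0, 1)), polygonForm S (0, 1) (-1, 0)))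
    (fun e => hP.ne' (by simpa using congrArg Prod.fst e))
  rw [polygonForm_expand hS] at h
  set P := polygonForm S (0, 1) (0, 1)
  set Q := polygonForm S (0, 1) (-1, 0)
  set R := polygonForm S (-1, 0) (-1, 0)
  have : 0 < P * (P * R - Q ^ 2) := by linarith
  have := (mul_pos_iff_of_pos_left hP).mp this
  linarith

theorem isMatrixAngle_polygonAngle (n : ℕ) :
    IsMatrixAngle (IsTypeTwo (n := n)) polygonAngle := by
  have hgram : ∀ {A B : Mat n}, IsTypeTwo A B →
      0 < polygonForm (realSpectrum A B) (0, 1) (0, 1) ∧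
        0 < polygonForm (realSpectrum A B) (-1, 0) (-1, 0) ∧
          polygonForm (realSpectrum A B) (0, 1) (-1, 0) ^ 2 <
            polygonForm (realSpectrum A B) (0, 1) (0, 1) *
              polygonForm (realSpectrum A B) (-1, 0) (-1, 0) :=
    fun h => polygonForm_gram_pos (finite_realSpectrum h.1) (isTypeTwo_iff.mp h).2.2
  refine ⟨?_, ?_, ?_, ?_, ?_, ?_, ?_⟩
  · intro A B h c d hc hd
    have had : c * d - 0 * 0 ≠ 0 := by simp [hc.ne', hd.ne']
    have e1 : c • A = c • A + (0 : ℝ) • B := by simp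
    have e2 : d • B = (0 : ℝ) • A + d • B := by simp
    rw [e1, e2]
    refine ⟨h.comb had, ?_⟩
    obtain ⟨P, Q, R, hP, hQ, hR, hx⟩ := exists_polygonForm_expand (finite_realSpectrum h.1)
    rw [polygonAngle_comb h.1 had, polygonAngle, hP, hQ, hR, ← gramAngle_scale hc hd P Q R]
    simp only [hx]
    congr 1 <;> ring
  · intro A B h g hg
    rw [isTypeTwo_iff] at h ⊢
    rw [polygonAngle, polygonAngle, nonrealRoots_conj A B hg, realSpectrum_conj A B hg]
    exact ⟨⟨isRegularPencil_conj h.1 hg, h.2⟩, rfl⟩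
  · intro A B h
    have had : (0 : ℝ) * 0 - 1 * 1 ≠ 0 := by norm_num
    have e1 : B = (0 : ℝ) • A + (1 : ℝ) • B := by simp
    have e2 : A = (1 : ℝ) • A + (0 : ℝ) • B := by simp
    have h' := h.comb had
    have h'' := polygonAngle_comb h.1 had
    rw [← e1, ← e2] at h' h''
    refine ⟨h', ?_⟩
    obtain ⟨P, Q, R, hP, hQ, hR, hx⟩ := exists_polygonForm_expand (finite_realSpectrum h.1)
    rw [h'', polygonAngle, hP, hQ, hR, ← gramAngle_swap]
    simp only [hx]
    congr 1 <;> ring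
  · intro A B h
    have had : (-1 : ℝ) * 1 - 0 * 0 ≠ 0 := by norm_num
    have e1 : -A = (-1 : ℝ) • A + (0 : ℝ) • B := by simp
    have e2 : B = (0 : ℝ) • A + (1 : ℝ) • B := by simp
    have h' := h.comb had
    have h'' := polygonAngle_comb h.1 had
    rw [← e1, ← e2] at h' h''
    refine ⟨h', ?_⟩
    obtain ⟨P, Q, R, hP, hQ, hR, hx⟩ := exists_polygonForm_expand (finite_realSpectrum h.1)
    rw [h'', polygonAngle, hP, hQ, hR, ← gramAngle_neg]
    simp only [hx]
    congr 1 <;> ring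
  · intro A B h p q hp hq
    have had : (1 : ℝ) * q - 0 * p ≠ 0 := by simpa using hq.ne'
    have had' : p * (1 : ℝ) - q * 0 ≠ 0 := by simpa using hp.ne'
    have e1 : A = (1 : ℝ) • A + (0 : ℝ) • B := by simp
    have e2 : B = (0 : ℝ) • A + (1 : ℝ) • B := by simp
    have h1 := h.comb had
    have h2 := polygonAngle_comb h.1 had
    have h3 := h.comb had'
    have h4 := polygonAngle_comb h.1 had'
    rw [← e1] at h1 h2
    rw [← e2] at h3 h4
    refine ⟨h1, h3, ?_⟩
    obtain ⟨P, Q, R, hP, hQ, hR, hx⟩ := exists_polygonForm_expand (finite_realSpectrum h.1)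
    obtain ⟨hP', hR', hQ'⟩ := hgram h
    rw [hP] at hP'
    rw [hR] at hR'
    rw [hP, hQ, hR] at hQ'
    rw [h2, h4, polygonAngle, hP, hQ, hR, ← gramAngle_add hP' hR' hQ' hp hq]
    simp only [hx]
    congr 2 <;> ring
  · intro A B h
    exact gramAngle_pos (hgram h).2.2
  · intro A B h
    exact gramAngle_lt_pi (hgram h).2.2

/-! ### Explicit formulas -/

theorem radicand_eq {k : ℕ} (l : Fin k → ℝ) :
    radicand l = 4 * (cyclicForm (fun i => homCoord (l i)) (0, 1) (0, 1) *
      cyclicForm (fun i => homCoord (l i)) (-1, 0) (-1, 0)) := by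
  have h1 : ∑ i, 1 / (l (finRotate k i) - l i) =
      cyclicForm (fun i => homCoord (l i)) (-1, 0) (-1, 0) := by
    refine Finset.sum_congr rfl fun i _ => ?_
    simp only [pairForm, wedge, homCoord_coe]
    generalize l (finRotate k i) = y
    generalize l i = x
    by_cases h : y - x = 0
    · simp [h]
    · field_simp
      ring
  have h2 : ∑ i, (l (finRotate k i) + l i) ^ 2 / (l (finRotate k i) - l i) =
      4 * cyclicForm (fun i => homCoord (l i)) (0, 1) (0, 1) := by
    -- Subtracting this vanishing cyclic sum turns `(x + y)² / (y - x)` into `4xy / (y - x)`, which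
    -- is four times the form at `(0, 1)`.
    have h0 : ∑ i, (l (finRotate k i) - l i) = 0 := by
      rw [Finset.sum_sub_distrib, Equiv.sum_comp (finRotate k) l, sub_self]
    have h0' : ∑ i, (l (finRotate k i) + l i) ^ 2 / (l (finRotate k i) - l i) =
        ∑ i, (l (finRotate k i) + l i) ^ 2 / (l (finRotate k i) - l i) -
          ∑ i, (l (finRotate k i) - l i) := by rw [h0, sub_zero]
    rw [h0', ← Finset.sum_sub_distrib, cyclicForm, Finset.mul_sum]
    refine Finset.sum_congr rfl fun i _ => ?_
    simp only [pairForm, wedge, homCoord_coe]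
    generalize l (finRotate k i) = y
    generalize l i = x
    by_cases h : y - x = 0
    · simp [h]
    · field_simp
      ring
  rw [radicand, h1, h2]
  ring

theorem cosQuotient_eq {k : ℕ} (l : Fin k → ℝ) :
    cosQuotient l = cyclicForm (fun i => homCoord (l i)) (0, 1) (-1, 0) /
      Real.sqrt (cyclicForm (fun i => homCoord (l i)) (0, 1) (0, 1) *
        cyclicForm (fun i => homCoord (l i)) (-1, 0) (-1, 0)) := by
  have h1 : ∑ i, (l (finRotate k i) + l i) / (l (finRotate k i) - l i) =
      2 * cyclicForm (fun i => homCoord (l i)) (0, 1) (-1, 0) := by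
    rw [cyclicForm, Finset.mul_sum]
    refine Finset.sum_congr rfl fun i _ => ?_
    simp only [pairForm, wedge, homCoord_coe]
    generalize l (finRotate k i) = y
    generalize l i = x
    by_cases h : y - x = 0
    · simp [h]
    · field_simp
      ring
  rw [cosQuotient, h1, radicand_eq, Real.sqrt_mul (by norm_num),
    show Real.sqrt 4 = 2 by rw [show (4 : ℝ) = 2 ^ 2 by norm_num]; exact Real.sqrt_sq (by norm_num),
    mul_div_mul_left _ _ (by norm_num)]

theorem orient_coe_pos {k : ℕ} {l : Fin k → ℝ} (hl : StrictMono l) (i j m : Fin k)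
    (hij : i < j) (hjm : j < m) : 0 < orient (l i) (l j) (l m) := by
  rw [orient_coe]
  have h1 := hl hij
  have h2 := hl hjm
  exact mul_pos (mul_pos (by linarith) (by linarith)) (by linarith)

theorem polygonForm_range_coe {k : ℕ} {l : Fin (k + 2) → ℝ} (hl : StrictMono l) (u v : ℝ × ℝ) :
    polygonForm (Set.range fun i => (l i : OnePoint ℝ)) u v =
      cyclicForm (fun i => homCoord (l i)) u v :=
  polygonForm_range (OnePoint.coe_injective.comp hl.injective) (orient_coe_pos hl) u v

theorem radicand_pos_and_abs_cosQuotient_le_one {k : ℕ} {l : Fin k → ℝ} (hk : 3 ≤ k)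
    (hl : StrictMono l) : 0 < radicand l ∧ |cosQuotient l| ≤ 1 := by
  obtain ⟨k, rfl⟩ : ∃ j, k = j + 2 := ⟨k - 2, by omega⟩
  have hinj : Function.Injective fun i => (l i : OnePoint ℝ) :=
    OnePoint.coe_injective.comp hl.injective
  have hcard : (Set.range fun i => (l i : OnePoint ℝ)).ncard = k + 2 := by
    rw [← Set.image_univ, Set.ncard_image_of_injective _ hinj, Set.ncard_univ]
    simp
  obtain ⟨hP, hR, hQ⟩ := polygonForm_gram_pos (Set.finite_range fun i => (l i : OnePoint ℝ))
    (by rw [hcard]; exact hk)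
  simp only [polygonForm_range_coe hl] at hP hR hQ
  rw [radicand_eq, cosQuotient_eq]
  exact ⟨by positivity, (abs_div_sqrt_lt_one hQ).le⟩

theorem IsTypeTwo.polygonAngle_eq_arccos {n k : ℕ} {A B : Mat n} (h : IsTypeTwo A B)
    {l : Fin k → ℝ} (hl : StrictMono l)
    (hE : genEigenvalues A B = Set.range (fun i => realPoint (l i))) :
    polygonAngle A B = Real.arccos (cosQuotient l) := by
  have hS : realSpectrum A B = Set.range fun i => (l i : OnePoint ℝ) := by
    apply extendedOfReal_injective.image_injective
    rw [← genEigenvalues_eq_image h.2.1, hE, ← Set.range_comp]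
    rfl
  have h3 := (isTypeTwo_iff.mp h).2.2
  rw [hS, ← Set.image_univ, Set.ncard_image_of_injective (f := fun i => (l i : OnePoint ℝ)) _
    (OnePoint.coe_injective.comp hl.injective), Set.ncard_univ, Nat.card_fin] at h3
  obtain ⟨k, rfl⟩ : ∃ j, k = j + 2 := ⟨k - 2, by omega⟩
  rw [polygonAngle, hS, gramAngle, cosQuotient_eq]
  simp only [polygonForm_range_coe hl]

theorem tendsto_pairForm {ι : Type*} {f : Filter ι} {a b : ι → ℝ × ℝ} {a₀ b₀ : ℝ × ℝ}
    (ha : Filter.Tendsto a f (nhds a₀)) (hb : Filter.Tendsto b f (nhds b₀))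
    (h : wedge a₀ b₀ ≠ 0) (u v : ℝ × ℝ) :
    Filter.Tendsto (fun x => pairForm u v (a x) (b x)) f (nhds (pairForm u v a₀ b₀)) := by
  have ha1 := (continuous_fst.tendsto _).comp ha
  have ha2 := (continuous_snd.tendsto _).comp ha
  have hb1 := (continuous_fst.tendsto _).comp hb
  have hb2 := (continuous_snd.tendsto _).comp hb
  refine Filter.Tendsto.div ?_ ?_ (mul_ne_zero two_ne_zero h)
  · exact ((((ha1.const_mul u.2).sub (ha2.const_mul u.1)).mul
      ((hb1.const_mul v.2).sub (hb2.const_mul v.1))).add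
      (((ha1.const_mul v.2).sub (ha2.const_mul v.1)).mul
      ((hb1.const_mul u.2).sub (hb2.const_mul u.1))))
  · exact ((ha2.mul hb1).sub (ha1.mul hb2)).const_mul 2

/-- Moving the last of a family of points to infinity. -/
theorem tendsto_cyclicForm_snoc {k : ℕ} {l : Fin (k + 1) → ℝ} (hl : Function.Injective l)
    (u v : ℝ × ℝ) :
    Filter.Tendsto (fun x : ℝ => cyclicForm
        (fun i => homCoord ((Fin.snoc l x : Fin (k + 2) → ℝ) i)) u v) Filter.atTop
      (nhds (cyclicForm (fun i => homCoord
        ((Fin.snoc (fun i => (l i : OnePoint ℝ)) OnePoint.infty : Fin (k + 2) → OnePoint ℝ) i))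
        u v)) := by
  let w : Fin (k + 2) → OnePoint ℝ := Fin.snoc (fun i => (l i : OnePoint ℝ)) OnePoint.infty
  have hw : Function.Injective w := by
    rw [Fin.snoc_injective_iff]
    exact ⟨OnePoint.coe_injective.comp hl, by rintro ⟨i, hi⟩; exact OnePoint.coe_ne_infty _ hi⟩
  -- The coordinates `(x, 1)` of the last point are rescaled to `(1, x⁻¹)`, which tends to those of
  -- `∞`. By `pairForm_smul` the rescaling is harmless.
  let ρ : ℝ → Fin (k + 2) → ℝ × ℝ := fun x => Fin.snoc (fun i => (l i, 1)) (1, x⁻¹)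
  have hρ : ∀ i, Filter.Tendsto (fun x => ρ x i) Filter.atTop (nhds (homCoord (w i))) := by
    intro i
    induction i using Fin.lastCases with
    | last =>
      simp only [ρ, w, Fin.snoc_last, homCoord_infty]
      exact tendsto_const_nhds.prodMk_nhds tendsto_inv_atTop_zero
    | cast i =>
      simp only [ρ, w, Fin.snoc_castSucc, homCoord_coe]
      exact tendsto_const_nhds
  have hscale : ∀ x : ℝ, 0 < x → ∀ i, ∃ c : ℝ, c ≠ 0 ∧
      homCoord ((Fin.snoc l x : Fin (k + 2) → ℝ) i) = c • ρ x i := by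
    intro x hx i
    induction i using Fin.lastCases with
    | last =>
      refine ⟨x, hx.ne', ?_⟩
      simp [ρ, hx.ne']
    | cast i => exact ⟨1, one_ne_zero, by simp [ρ]⟩
  refine tendsto_finsetSum _ fun i _ => ?_
  have hne : wedge (homCoord (w i)) (homCoord (w (finRotate (k + 2) i))) ≠ 0 := by
    refine wedge_homCoord_ne_zero fun e => ?_
    have := hw e
    rw [finRotate_apply] at this
    simp at this
  refine (tendsto_pairForm (hρ i) (hρ (finRotate (k + 2) i)) hne u v).congr' ?_
  filter_upwards [Filter.eventually_gt_atTop 0] with x hx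
  obtain ⟨c, hc, e⟩ := hscale x hx i
  obtain ⟨d, hd, e'⟩ := hscale x hx (finRotate (k + 2) i)
  rw [e, e', pairForm_smul _ _ _ _ hc hd]

theorem IsTypeTwo.tendsto_arccos {n k : ℕ} {A B : Mat n} (h : IsTypeTwo A B)
    {l : Fin k → ℝ} (hl : StrictMono l)
    (hE : genEigenvalues A B = insert OnePoint.infty (Set.range (fun i => realPoint (l i)))) :
    Filter.Tendsto (fun x : ℝ => Real.arccos (cosQuotient (Fin.snoc l x : Fin (k + 1) → ℝ)))
      Filter.atTop (nhds (polygonAngle A B)) := by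
  let w : Fin (k + 1) → OnePoint ℝ := Fin.snoc (fun i => (l i : OnePoint ℝ)) OnePoint.infty
  have hw : Function.Injective w := by
    rw [Fin.snoc_injective_iff]
    exact ⟨OnePoint.coe_injective.comp hl.injective,
      by rintro ⟨i, hi⟩; exact OnePoint.coe_ne_infty _ hi⟩
  have hS : realSpectrum A B = Set.range w := by
    apply extendedOfReal_injective.image_injective
    rw [← genEigenvalues_eq_image h.2.1, hE, Fin.range_snoc, Set.image_insert_eq,
      ← Set.range_comp]
    rfl
  have h3 := (isTypeTwo_iff.mp h).2.2
  obtain ⟨hP, hR, hQ⟩ := polygonForm_gram_pos (finite_realSpectrum h.1) h3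
  rw [hS, ← Set.image_univ, Set.ncard_image_of_injective _ hw, Set.ncard_univ,
    Nat.card_fin] at h3
  obtain ⟨k, rfl⟩ : ∃ j, k = j + 1 := ⟨k - 1, by omega⟩
  -- In the positive cyclic order `∞` follows all the increasing reals.
  have horient : ∀ i j m, i < j → j < m → 0 < orient (w i) (w j) (w m) := by
    intro i j m hij hjm
    induction m using Fin.lastCases with
    | last =>
      induction j using Fin.lastCases with
      | last => exact absurd hjm (lt_irrefl _)
      | cast j =>
        induction i using Fin.lastCases with
        | last => exact absurd hij (Fin.castSucc_lt_last j).not_gt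
        | cast i =>
          have := hl (Fin.castSucc_lt_castSucc_iff.mp hij)
          simp [w, orient, wedge]
          linarith
    | cast m =>
      induction j using Fin.lastCases with
      | last => exact absurd hjm (Fin.castSucc_lt_last m).not_gt
      | cast j =>
        induction i using Fin.lastCases with
        | last => exact absurd hij (Fin.castSucc_lt_last j).not_gt
        | cast i =>
          simp only [w, Fin.snoc_castSucc]
          exact orient_coe_pos hl i j m (Fin.castSucc_lt_castSucc_iff.mp hij)
            (Fin.castSucc_lt_castSucc_iff.mp hjm)
  rw [hS] at hP hR hQ
  rw [polygonAngle, hS, gramAngle]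
  simp only [polygonForm_range hw horient] at hP hR hQ ⊢
  simp only [cosQuotient_eq]
  refine (Real.continuous_arccos.tendsto _).comp (Filter.Tendsto.div ?_ ?_ ?_)
  · exact tendsto_cyclicForm_snoc hl.injective _ _
  · exact (Real.continuous_sqrt.tendsto _).comp ((tendsto_cyclicForm_snoc hl.injective _ _).mul
      (tendsto_cyclicForm_snoc hl.injective _ _))
  · exact (Real.sqrt_pos.mpr (mul_pos hP hR)).ne'

/-! ### Linear algebra of pencils with two singular members -/

/-- A nilpotent matrix commuting with the centralizer of `T` is a commutator with `T`. -/
theorem exists_commutator_eq {n : ℕ} {T N : Mat n} (hN : IsNilpotent N)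
    (hc : ∀ Z, Commute Z T → Commute Z N) : ∃ Y : Mat n, T * Y - Y * T = N := by
  let L : Mat n →ₗ[ℝ] Mat n := LinearMap.mulLeft ℝ T - LinearMap.mulRight ℝ T
  suffices N ∈ LinearMap.range L by
    obtain ⟨Y, hY⟩ := this
    exact ⟨Y, by simpa [L] using hY⟩
  -- Otherwise a functional kills all commutators with `T` but not `N`. It is the trace against some
  -- `Z`, which must then commute with `T`, hence with `N`; so `ZN` is nilpotent and has trace zero,
  -- a contradiction.
  by_contra hmem
  obtain ⟨f, hf, hker⟩ := Submodule.exists_le_ker_of_notMem hmem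
  let Z : Mat n := Matrix.of fun i j => f (Matrix.single j i 1)
  have hfZ : ∀ M, f M = (Z * M).trace := by
    intro M
    conv_lhs => rw [matrix_eq_sum_single M]
    simp only [map_sum, Matrix.trace, Matrix.diag_apply, Matrix.mul_apply]
    rw [Finset.sum_comm]
    refine Finset.sum_congr rfl fun i _ => Finset.sum_congr rfl fun j _ => ?_
    have : Matrix.single j i (M j i) = M j i • Matrix.single j i (1 : ℝ) := by
      rw [Matrix.smul_single, smul_eq_mul, mul_one]
    rw [this, map_smul, smul_eq_mul, mul_comm]
    rfl
  have hZ : Z * T = T * Z := by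
    rw [Matrix.ext_iff_trace_mul_right]
    intro Y
    have h0 : f (L Y) = 0 := hker ⟨Y, rfl⟩
    rw [hfZ] at h0
    simp only [L, LinearMap.sub_apply, LinearMap.mulLeft_apply, LinearMap.mulRight_apply,
      Matrix.mul_sub, Matrix.trace_sub] at h0
    rw [Matrix.mul_assoc, Matrix.mul_assoc, Matrix.trace_mul_comm T, Matrix.mul_assoc]
    linarith
  have : IsNilpotent (Z * N) := (hc Z hZ).isNilpotent_mul_left hN
  apply hf
  rw [hfZ]
  exact (Matrix.isNilpotent_trace_of_isNilpotent this).eq_zero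

/-- Over `ℂ` the characteristic polynomial has only the factors `X` and `X - 1`, so it divides a
power of `X - X²`; Cayley–Hamilton then applies. -/
theorem isNilpotent_sub_mul_self {n : ℕ} {T : Mat n}
    (h : ∀ z : ℂ, (T.map Complex.ofReal - z • 1).det = 0 → z = 0 ∨ z = 1) :
    IsNilpotent (T - T * T) := by
  set C := T.map Complex.ofReal with hC
  have hmap : (T - T * T).map Complex.ofReal = C - C * C := by
    change (T - T * T).map Complex.ofRealHom = T.map Complex.ofRealHom - T.map Complex.ofRealHom * _
    rw [Matrix.map_sub _ (map_sub _), Matrix.map_mul]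
    rfl
  have hroots : ∀ z ∈ C.charpoly.roots, z = 0 ∨ z = 1 := by
    intro z hz
    have hz' := Polynomial.isRoot_of_mem_roots hz
    rw [Polynomial.IsRoot, Matrix.eval_charpoly] at hz'
    apply h
    rw [Matrix.scalar_apply] at hz'
    rw [← neg_sub, Matrix.det_neg, Matrix.smul_one_eq_diagonal, hz', mul_zero]
  have hdvd : C.charpoly ∣ (Polynomial.X - Polynomial.X * Polynomial.X) ^
      Multiset.card C.charpoly.roots := by
    have hsplit := (IsAlgClosed.splits C.charpoly).eq_prod_roots_of_monic C.charpoly_monic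
    rw [← Multiset.prod_replicate, ← Multiset.map_const']
    conv_lhs => rw [hsplit]
    apply Multiset.prod_dvd_prod_of_dvd
    intro z hz
    rcases hroots z hz with rfl | rfl
    · exact ⟨1 - Polynomial.X, by simp; ring⟩
    · exact ⟨-Polynomial.X, by simp; ring⟩
  obtain ⟨q, hq⟩ := hdvd
  have hnil : IsNilpotent (C - C * C) := by
    refine ⟨Multiset.card C.charpoly.roots, ?_⟩
    have := congrArg (Polynomial.aeval C) hq
    rwa [map_mul, Matrix.aeval_self_charpoly, zero_mul, map_pow, map_sub, map_mul,
      Polynomial.aeval_X] at this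
  rw [← hmap] at hnil
  exact (IsNilpotent.map_iff (f := Complex.ofRealHom.mapMatrix)
    (fun _ _ h => Matrix.map_injective Complex.ofReal_injective h)).mp hnil

/-- Put `S = M₁ + M₂` and `T = S⁻¹M₁`; only `0` and `1` can be eigenvalues of `T`. If `T` is
idempotent, half the transpose of `T` is a solution. In general `T - T²` is nilpotent and equals a
commutator `TY - YT`, and `Y` supplies the correction for the Jordan blocks. -/
theorem exists_infinitesimal_scaling {n : ℕ} {M₁ M₂ : Mat n} (h₁ : M₁.IsSymm) (h₂ : M₂.IsSymm)
    (h : ∀ x y : ℂ, pencilForm M₁ M₂ x y = 0 → x = 0 ∨ y = 0) :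
    ∃ X : Mat n, X * M₁ + M₁ * Xᵀ = M₁ ∧ X * M₂ + M₂ * Xᵀ = 0 := by
  set S := M₁ + M₂ with hS
  have hSdet : IsUnit S.det := by
    rw [isUnit_iff_ne_zero]
    intro h0
    have : pencilForm M₁ M₂ 1 1 = 0 := by
      rw [pencilForm, one_smul, one_smul, ← Matrix.map_add _ Complex.ofReal_add]
      have := RingHom.map_det Complex.ofRealHom S
      rw [h0, map_zero] at this
      exact this.symm
    simpa using h 1 1 this
  have hSs : Sᵀ = S := (h₁.add h₂).eq
  obtain ⟨T, hST⟩ : ∃ T, S * T = M₁ := ⟨S⁻¹ * M₁, Matrix.mul_nonsing_inv_cancel_left _ _ hSdet⟩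
  have hTS : Tᵀ * S = S * T := by
    have := congrArg Matrix.transpose hST
    rw [transpose_mul, hSs, h₁.eq] at this
    rw [this, hST]
  have hnil : IsNilpotent (T - T * T) := by
    apply isNilpotent_sub_mul_self
    intro z hz
    have e : (1 - z) • M₁.map Complex.ofReal + (-z) • M₂.map Complex.ofReal =
        S.map Complex.ofReal * (T.map Complex.ofReal - z • 1) := by
      have e1 : S.map Complex.ofReal * T.map Complex.ofReal = M₁.map Complex.ofReal := by
        rw [← hST]; exact (Matrix.map_mul (f := Complex.ofRealHom)).symm
      rw [Matrix.mul_sub, e1, Matrix.mul_smul, Matrix.mul_one, hS,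
        Matrix.map_add _ Complex.ofReal_add, smul_add, sub_smul, neg_smul, one_smul]
      abel
    have : pencilForm M₁ M₂ (1 - z) (-z) = 0 := by
      rw [pencilForm, e, det_mul, hz, mul_zero]
    rcases h _ _ this with h0 | h0
    · right; linear_combination -h0
    · left; linear_combination -h0
  obtain ⟨Y, hY⟩ := exists_commutator_eq (T := T) hnil
    fun Z hZ => hZ.sub_right (hZ.mul_right hZ)
  -- The part of `V` containing `Y` is skew for `S`, so it drops out of `VᵀS + SV = M₁`; in `VᵀM₁ +
  -- M₁V` it compensates for `T - T²`.
  let V : Mat n := (1 / 2 : ℝ) • (Y - S⁻¹ * Yᵀ * S + T)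
  have hSV : S * V = (1 / 2 : ℝ) • (S * Y - Yᵀ * S + S * T) := by
    simp only [V, Matrix.mul_smul, Matrix.mul_add, Matrix.mul_sub]
    rw [Matrix.mul_assoc S⁻¹, Matrix.mul_nonsing_inv_cancel_left _ _ hSdet]
  have hVS : Vᵀ * S = (1 / 2 : ℝ) • (Yᵀ * S - S * Y + S * T) := by
    have := congrArg Matrix.transpose hSV
    rw [transpose_mul, hSs] at this
    rw [this]
    simp only [transpose_smul, transpose_add, transpose_sub, transpose_mul, transpose_transpose,
      hSs, hTS]
  have hYt : Yᵀ * Tᵀ - Tᵀ * Yᵀ = Tᵀ - Tᵀ * Tᵀ := by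
    have := congrArg Matrix.transpose hY
    simpa only [transpose_sub, transpose_mul] using this
  have hsum : Vᵀ * S + S * V = S * T := by
    rw [hSV, hVS, ← smul_add]
    have : Yᵀ * S - S * Y + S * T + (S * Y - Yᵀ * S + S * T) = (2 : ℝ) • (S * T) := by
      rw [two_smul]; abel
    rw [this, smul_smul]
    norm_num
  have h1 : Vᵀ * M₁ + M₁ * V = M₁ := by
    have e1 : Vᵀ * M₁ = (1 / 2 : ℝ) • ((Yᵀ * S - S * Y + S * T) * T) := by
      rw [← hST, ← Matrix.mul_assoc, hVS, Matrix.smul_mul]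
    have e2 : M₁ * V = (1 / 2 : ℝ) • (Tᵀ * (S * Y - Yᵀ * S + S * T)) := by
      have : M₁ * V = Tᵀ * (S * V) := by rw [← Matrix.mul_assoc, hTS, hST]
      rw [this, hSV, Matrix.mul_smul]
    have e3 : (Yᵀ * S - S * Y + S * T) * T + Tᵀ * (S * Y - Yᵀ * S + S * T) =
        S * (T * Y - Y * T) + (Yᵀ * Tᵀ - Tᵀ * Yᵀ) * S + (2 : ℝ) • (S * (T * T)) := by
      have a1 : Yᵀ * S * T = Yᵀ * Tᵀ * S := by rw [Matrix.mul_assoc, ← hTS, Matrix.mul_assoc]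
      have a2 : Tᵀ * (S * Y) = S * T * Y := by rw [← Matrix.mul_assoc, hTS]
      have a3 : Tᵀ * (S * T) = S * (T * T) := by
        rw [← Matrix.mul_assoc, hTS, Matrix.mul_assoc]
      simp only [Matrix.add_mul, Matrix.sub_mul, Matrix.mul_add, Matrix.mul_sub, a1, a2, a3,
        two_smul, Matrix.mul_assoc]
      abel
    have e4 : (Tᵀ - Tᵀ * Tᵀ) * S = S * (T - T * T) := by
      rw [Matrix.sub_mul, Matrix.mul_assoc, hTS, ← Matrix.mul_assoc, hTS, Matrix.mul_sub,
        Matrix.mul_assoc]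
    rw [e1, e2, ← smul_add, e3, hY, hYt, e4, ← hST]
    have : S * (T - T * T) + S * (T - T * T) + (2 : ℝ) • (S * (T * T)) = (2 : ℝ) • (S * T) := by
      rw [two_smul, two_smul, Matrix.mul_sub]; abel
    rw [this, smul_smul]
    norm_num
  refine ⟨Vᵀ, by rw [transpose_transpose, h1], ?_⟩
  have h2 : M₂ = S - M₁ := by rw [hS]; abel
  rw [transpose_transpose, h2, Matrix.mul_sub, Matrix.sub_mul]
  calc Vᵀ * S - Vᵀ * M₁ + (S * V - M₁ * V) = Vᵀ * S + S * V - (Vᵀ * M₁ + M₁ * V) := by abel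
    _ = 0 := by rw [hsum, h1, hST, sub_self]

/-! ### From infinitesimal to actual scalings. -/

theorem exp_smul_one {n : ℕ} (c : ℝ) :
    NormedSpace.exp (c • (1 : Mat n)) = Real.exp c • (1 : Mat n) := by
  have h : NormedSpace.exp (fun _ : Fin n => c) = fun _ => Real.exp c := by
    ext i
    rw [Pi.coe_exp, Real.exp_eq_exp_ℝ]
  rw [Matrix.smul_one_eq_diagonal, Matrix.exp_diagonal, h, Matrix.smul_one_eq_diagonal]

theorem semiconjBy_exp {n : ℕ} {M X Y : Mat n} (h : SemiconjBy M X Y) :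
    SemiconjBy M (NormedSpace.exp X) (NormedSpace.exp Y) := by
  rw [NormedSpace.exp_eq_tsum ℚ]
  refine SemiconjBy.tsum_right M ?_ ?_ fun _ => (h.pow_right _).smul_right _
  · exact open scoped Matrix.Norms.Operator in NormedSpace.expSeries_summable' _
  · exact open scoped Matrix.Norms.Operator in NormedSpace.expSeries_summable' _

/-- The hypothesis says `MXᵀ = (c - X)M`. Exponentiating moves `M` past the transposed factor, and
`exp X · exp (c - X)` is the scalar `e^c`. -/
theorem exp_mul_mul_exp_transpose {n : ℕ} {X M : Mat n} {c : ℝ} (h : X * M + M * Xᵀ = c • M) :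
    NormedSpace.exp X * M * (NormedSpace.exp X)ᵀ = Real.exp c • M := by
  have hs : SemiconjBy M Xᵀ (c • 1 - X) := by
    rw [SemiconjBy, Matrix.sub_mul, Matrix.smul_mul, Matrix.one_mul, ← h]
    abel
  have h1 := (semiconjBy_exp hs).eq
  have h2 : NormedSpace.exp X * NormedSpace.exp (c • 1 - X) = Real.exp c • (1 : Mat n) := by
    rw [← Matrix.exp_add_of_commute, add_sub_cancel, exp_smul_one]
    exact ((Commute.one_right X).smul_right c).sub_right (Commute.refl X)
  rw [← Matrix.exp_transpose, Matrix.mul_assoc, h1, ← Matrix.mul_assoc, h2, Matrix.smul_mul,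
    Matrix.one_mul]

/-- An exponential is the square of the invertible `exp (X/2)`. -/
theorem det_exp_pos {n : ℕ} (X : Mat n) : 0 < (NormedSpace.exp X).det := by
  have h : NormedSpace.exp X = NormedSpace.exp ((1 / 2 : ℝ) • X) * NormedSpace.exp ((1 / 2 : ℝ) • X) := by
    rw [← Matrix.exp_add_of_commute _ _ (Commute.refl _), ← add_smul]
    norm_num
  have hu := (Matrix.isUnit_iff_isUnit_det _).mp (Matrix.isUnit_exp ((1 / 2 : ℝ) • X))
  rw [h, det_mul]
  exact mul_self_pos.mpr hu.ne_zero

theorem exists_pos_pow_mul_eq_one {n : ℕ} (hn : n ≠ 0) {d : ℝ} (hd : 0 < d) :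
    ∃ c : ℝ, 0 < c ∧ c ^ n * d = 1 := by
  refine ⟨d⁻¹ ^ ((n : ℝ)⁻¹), by positivity, ?_⟩
  rw [Real.rpow_inv_natCast_pow (by positivity) hn, inv_mul_cancel₀ hd.ne']

/-- An element of `SL(n,ℝ)` scaling the two singular members of a pencil differently. -/
theorem exists_specialLinear_scaling {n : ℕ} (hn : n ≠ 0) {M₁ M₂ : Mat n} (h₁ : M₁.IsSymm)
    (h₂ : M₂.IsSymm) (h : ∀ x y : ℂ, pencilForm M₁ M₂ x y = 0 → x = 0 ∨ y = 0) :
    ∃ (g : SL n) (α β : ℝ), 0 < β ∧ β < α ∧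
      (↑g⁻¹ : Mat n) * M₁ * (↑g⁻¹ : Mat n)ᵀ = α • M₁ ∧
      (↑g⁻¹ : Mat n) * M₂ * (↑g⁻¹ : Mat n)ᵀ = β • M₂ := by
  obtain ⟨X, hX₁, hX₂⟩ := exists_infinitesimal_scaling h₁ h₂ h
  have e₁ := exp_mul_mul_exp_transpose (c := 1) (by rw [hX₁, one_smul])
  have e₂ := exp_mul_mul_exp_transpose (c := 0) (by rw [hX₂, zero_smul])
  obtain ⟨c, hc, hcd⟩ := exists_pos_pow_mul_eq_one hn (det_exp_pos X)
  -- Normalizing the determinant multiplies both factors by `c²`, so their ratio remains `e`. The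
  -- inverse of `k` is used below because normal vectors transform by `g⁻¹`.
  let k : SL n := ⟨c • NormedSpace.exp X, by rw [det_smul, Fintype.card_fin, hcd]⟩
  have hk : ∀ M : Mat n, (↑k : Mat n) * M * (↑k : Mat n)ᵀ =
      (c * c) • (NormedSpace.exp X * M * (NormedSpace.exp X)ᵀ) := by
    intro M
    change (c • NormedSpace.exp X) * M * (c • NormedSpace.exp X)ᵀ = _
    rw [transpose_smul, Matrix.smul_mul, Matrix.smul_mul, Matrix.mul_smul, smul_smul]
  refine ⟨k⁻¹, c * c * Real.exp 1, c * c * Real.exp 0, by positivity, ?_, ?_, ?_⟩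
  · exact mul_lt_mul_of_pos_left (Real.exp_lt_exp.mpr one_pos) (by positivity)
  · rw [inv_inv, hk, e₁, smul_smul]
  · rw [inv_inv, hk, e₂, smul_smul]

/-! ### Indefinite matrices -/

open scoped MatrixOrder Matrix.Norms.L2Operator in
theorem PosSemidef.exists_eq_conjTranspose_mul_self {n : ℕ} {M : Mat n} (h : M.PosSemidef) :
    ∃ B : Mat n, M = Bᴴ * B :=
  CStarAlgebra.nonneg_iff_eq_star_mul_self.mp h.nonneg

/-- Otherwise `-A = BᵀB`; with `X = CᵀC`, the vanishing trace is minus the squared norm of `CBᵀ`, so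
`XBᵀ = 0` and `B = 0`. -/
theorem exists_dotProduct_mulVec_pos {n : ℕ} {A X : Mat n} (hA : A.IsSymm) (hA0 : A ≠ 0)
    (hX : X ∈ PSpace n) (h : (X * A).trace = 0) : ∃ x, 0 < x ⬝ᵥ (A *ᵥ x) := by
  by_contra! hneg
  have hpsd : (-A).PosSemidef := by
    refine PosSemidef.of_dotProduct_mulVec_nonneg ?_ fun x => ?_
    · rw [IsHermitian, conjTranspose_eq_transpose_of_trivial, transpose_neg, hA.eq]
    · rw [neg_mulVec, dotProduct_neg, star_trivial]
      linarith [hneg x]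
  obtain ⟨B, hB⟩ := PosSemidef.exists_eq_conjTranspose_mul_self hpsd
  obtain ⟨C, hC⟩ := PosSemidef.exists_eq_conjTranspose_mul_self hX.1.posSemidef
  have hXu : IsUnit X.det := by rw [hX.2]; exact isUnit_one
  have htr : ((C * Bᴴ)ᴴ * (C * Bᴴ)).trace = 0 := by
    have e : (C * Bᴴ)ᴴ * (C * Bᴴ) = B * (X * Bᴴ) := by
      rw [conjTranspose_mul, conjTranspose_conjTranspose, hC]
      simp only [Matrix.mul_assoc]
    rw [e, trace_mul_comm, Matrix.mul_assoc, ← hB, Matrix.mul_neg, trace_neg, h, neg_zero]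
  have h0 : C * Bᴴ = 0 := by
    rw [← conjTranspose_mul_self_eq_zero]
    exact (posSemidef_conjTranspose_mul_self _).trace_eq_zero_iff.mp htr
  have hB0 : Bᴴ = 0 := by
    have : X * Bᴴ = 0 := by rw [hC, Matrix.mul_assoc, h0, Matrix.mul_zero]
    rw [← Matrix.nonsing_inv_mul_cancel_left X Bᴴ hXu, this, Matrix.mul_zero]
  apply hA0
  rw [← neg_eq_zero, hB, hB0, Matrix.zero_mul]

/-- Adding to the identity a nonnegative multiple of `vvᵀ`, for a vector whose value under the form
balances the sign of the trace of `C`, makes the trace pairing zero. Rescaling then gives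
determinant one. -/
theorem normalSpace_nonempty_of_indefinite {n : ℕ} (hn : n ≠ 0) {C : Mat n} {x y : Fin n → ℝ}
    (hx : 0 < x ⬝ᵥ (C *ᵥ x)) (hy : y ⬝ᵥ (C *ᵥ y) < 0) : (normalSpace C).Nonempty := by
  obtain ⟨s, v, hs, hsv⟩ : ∃ (s : ℝ) (v : Fin n → ℝ), 0 ≤ s ∧
      C.trace + s * (v ⬝ᵥ (C *ᵥ v)) = 0 := by
    rcases le_or_gt 0 C.trace with h | h
    · refine ⟨-C.trace / (y ⬝ᵥ (C *ᵥ y)), y, div_nonneg_of_nonpos (by linarith) hy.le, ?_⟩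
      rw [div_mul_cancel₀ _ hy.ne, add_neg_cancel]
    · refine ⟨-C.trace / (x ⬝ᵥ (C *ᵥ x)), x, div_nonneg (by linarith) hx.le, ?_⟩
      rw [div_mul_cancel₀ _ hx.ne', add_neg_cancel]
  let X : Mat n := 1 + s • vecMulVec v v
  have hX : X.PosDef := by
    refine PosDef.one.add_posSemidef (PosSemidef.smul ?_ hs)
    simpa using posSemidef_vecMulVec_self_star v
  have htr : (X * C).trace = 0 := by
    rw [Matrix.add_mul, Matrix.one_mul, Matrix.smul_mul, vecMulVec_mul, trace_add, trace_smul,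
      trace_vecMulVec, smul_eq_mul, dotProduct_comm, ← dotProduct_mulVec, hsv]
  obtain ⟨c, hc, hcd⟩ := exists_pos_pow_mul_eq_one hn hX.det_pos
  refine ⟨c • X, ⟨hX.smul hc, ?_⟩, ?_⟩
  · rw [det_smul, Fintype.card_fin, hcd]
  · rw [Matrix.smul_mul, trace_smul, htr, smul_zero]

/-- A combination of normal vectors need not be one. But a normal vector is indefinite, and this is
an open condition, so it survives a small perturbation. -/
theorem exists_normalVector_add_smul {n : ℕ} (hn : n ≠ 0) (A B : NormalVector n)
    (hAB : ∀ x y : ℝ, x • A.mat + y • B.mat = 0 → x = 0 ∧ y = 0) :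
    ∃ (ε : ℝ) (C : NormalVector n), 0 < ε ∧ C.mat = A.mat + ε • B.mat := by
  obtain ⟨X, hX, htr⟩ := A.nonempty
  obtain ⟨x, hx⟩ := exists_dotProduct_mulVec_pos A.symm A.ne_zero hX htr
  obtain ⟨y, hy⟩ := exists_dotProduct_mulVec_pos A.symm.neg (neg_ne_zero.mpr A.ne_zero) hX
    (by rw [Matrix.mul_neg, trace_neg, htr, neg_zero])
  rw [neg_mulVec, dotProduct_neg] at hy
  have hform : ∀ (v : Fin n → ℝ) (ε : ℝ), v ⬝ᵥ ((A.mat + ε • B.mat) *ᵥ v) =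
      v ⬝ᵥ (A.mat *ᵥ v) + ε * (v ⬝ᵥ (B.mat *ᵥ v)) := by
    intro v ε
    rw [add_mulVec, smul_mulVec, dotProduct_add, dotProduct_smul, smul_eq_mul]
  have hlim : ∀ v : Fin n → ℝ, Filter.Tendsto (fun ε : ℝ => v ⬝ᵥ ((A.mat + ε • B.mat) *ᵥ v))
      (nhdsWithin 0 (Set.Ioi 0)) (nhds (v ⬝ᵥ (A.mat *ᵥ v))) := by
    intro v
    simp only [hform]
    have : Continuous fun ε : ℝ => v ⬝ᵥ (A.mat *ᵥ v) + ε * (v ⬝ᵥ (B.mat *ᵥ v)) := by fun_prop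
    have := this.tendsto 0
    rw [zero_mul, add_zero] at this
    exact this.mono_left nhdsWithin_le_nhds
  obtain ⟨ε, h1, h2, h3⟩ := (((hlim x).eventually_const_lt hx).and
    (((hlim y).eventually_lt_const (show y ⬝ᵥ (A.mat *ᵥ y) < 0 by linarith)).and
      self_mem_nhdsWithin)).exists
  refine ⟨ε, ⟨A.mat + ε • B.mat, A.symm.add (B.symm.smul ε), fun h0 => ?_,
    normalSpace_nonempty_of_indefinite hn h1 h2⟩, h3, rfl⟩
  have := (hAB 1 ε (by rw [one_smul, h0])).1
  exact one_ne_zero this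

/-! ### Pairs on which no invariant angle function is defined -/

/-- No orbit of a co-oriented hyperplane moves monotonically between two hyperplanes forming an
angle. -/
theorem IsInvariantAngleFunction.not_mem_of_orbit {n : ℕ}
    {D : Set (CoHyperplane n × CoHyperplane n)} {θ : CoHyperplane n → CoHyperplane n → ℝ}
    (H : IsInvariantAngleFunction D θ) (σ : ℕ → CoHyperplane n) (τ : CoHyperplane n) (g : SL n)
    (hact : ∀ k, σ (k + 1) = (σ k).act g) (hne : σ 0 ≠ σ 1)
    (hbetween : ∀ k, LiesBetween (σ (k + 1)) (σ 0) τ)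
    (hbetween' : ∀ k, LiesBetween (σ (k + 1)) (σ 0) (σ (k + 2))) : (σ 0, τ) ∉ D := by
  intro hD
  have hmem : ∀ k, (σ 0, σ (k + 1)) ∈ D := fun k => (H.between_mem _ _ _ hD (hbetween k)).1
  have hstep : ∀ k, (σ k, σ (k + 1)) ∈ D ∧ θ (σ k) (σ (k + 1)) = θ (σ 0) (σ 1) := by
    intro k
    induction k with
    | zero => exact ⟨hmem 0, rfl⟩
    | succ k ih =>
      rw [hact (k + 1)]
      nth_rw 1 3 [hact k]
      exact ⟨H.act_mem _ _ ih.1 g, (H.act _ _ ih.1 g).trans ih.2⟩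
  -- Invariance makes all steps equal and additivity sums them, which contradicts the bound `π`.
  have hsum : ∀ k : ℕ, θ (σ 0) (σ (k + 1)) = (k + 1) * θ (σ 0) (σ 1) := by
    intro k
    induction k with
    | zero => simp
    | succ k ih =>
      rw [← H.additive _ _ _ (hmem (k + 1)) (hbetween' k), ih, (hstep (k + 1)).2]
      push_cast
      ring
  have hpos : 0 < θ (σ 0) (σ 1) :=
    lt_of_le_of_ne (H.nonneg _ _ (hmem 0)) fun h => hne ((H.eq_zero_iff _ _ (hmem 0)).mp h.symm)
  obtain ⟨k, hk⟩ := exists_nat_gt (Real.pi / θ (σ 0) (σ 1))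
  rw [div_lt_iff₀ hpos] at hk
  have := H.le_pi _ _ (hmem k)
  rw [hsum k] at this
  nlinarith

/-- The assertion that some element of `SL(n,ℝ)` scales `M₁` more than `M₂`. -/
def HasScaling {n : ℕ} (M₁ M₂ : Mat n) : Prop :=
  ∃ (g : SL n) (α β : ℝ), 0 < β ∧ β < α ∧
    (↑g⁻¹ : Mat n) * M₁ * (↑g⁻¹ : Mat n)ᵀ = α • M₁ ∧
    (↑g⁻¹ : Mat n) * M₂ * (↑g⁻¹ : Mat n)ᵀ = β • M₂

namespace IsInvariantAngleFunction

variable {n : ℕ} {D : Set (CoHyperplane n × CoHyperplane n)}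
  {θ : CoHyperplane n → CoHyperplane n → ℝ} (H : IsInvariantAngleFunction D θ)
include H

/-- The orbit of `A` tends in direction to `bM₂`, whose coordinates in the basis `A`, `B` are
`-bc/Δ` and `ab/Δ` with `Δ = ad - bc`. The sign hypotheses make the first nonnegative and the second
positive, so the orbit stays between `A` and `B`. -/
theorem not_mem_of_scaling {M₁ M₂ : Mat n}
    (hM : ∀ x y : ℝ, x • M₁ + y • M₂ = 0 → x = 0 ∧ y = 0) (hs : HasScaling M₂ M₁)
    {A B : NormalVector n} {a b c d : ℝ} (hA : A.mat = a • M₁ + b • M₂)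
    (hB : B.mat = c • M₁ + d • M₂) (h1 : 0 < a * b * (a * d - b * c))
    (h2 : b * c * (a * d - b * c) ≤ 0) : (A.perp, B.perp) ∉ D := by
  obtain ⟨g, β, α, hα, hαβ, hg₂, hg₁⟩ := hs
  have hβ : 0 < β := hα.trans hαβ
  have hΔ : a * d - b * c ≠ 0 := by intro h0; rw [h0, mul_zero] at h1; exact lt_irrefl _ h1
  have hab : a * b ≠ 0 := by intro h0; rw [h0, zero_mul] at h1; exact lt_irrefl _ h1
  let V : ℕ → NormalVector n := fun k => (NormalVector.act g)^[k] A
  have hV : ∀ k, (V k).mat = (α ^ k * a) • M₁ + (β ^ k * b) • M₂ := by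
    intro k
    induction k with
    | zero => simp only [pow_zero, one_mul]; exact hA
    | succ k ih =>
      have e : V (k + 1) = (V k).act g := Function.iterate_succ_apply' _ _ _
      rw [e]
      change (↑g⁻¹ : Mat n) * (V k).mat * (↑g⁻¹ : Mat n)ᵀ = _
      rw [ih, Matrix.mul_add, Matrix.add_mul, Matrix.mul_smul, Matrix.smul_mul, Matrix.mul_smul,
        Matrix.smul_mul, hg₁, hg₂, smul_smul, smul_smul, pow_succ, pow_succ]
      congr 2 <;> ring
  refine H.not_mem_of_orbit (fun k => (V k).perp) B.perp g (fun k => ?_) (fun e => ?_)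
    (fun k => ?_) (fun k => ?_)
  · exact congrArg NormalVector.perp (Function.iterate_succ_apply' (NormalVector.act g) k A)
  · obtain ⟨t, ht, e⟩ := NormalVector.exists_smul_of_perp_eq e
    rw [hV, hV] at e
    obtain ⟨e1, e2⟩ := hM (α ^ 1 * a - t * (α ^ 0 * a)) (β ^ 1 * b - t * (β ^ 0 * b)) (by
      rw [sub_smul, sub_smul, mul_smul t, mul_smul t, sub_add_sub_comm, e, smul_add, sub_self])
    have hα' : α = t := by
      apply mul_right_cancel₀ (left_ne_zero_of_mul hab)
      linear_combination e1
    have hβ' : β = t := by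
      apply mul_right_cancel₀ (right_ne_zero_of_mul hab)
      linear_combination e2
    exact hαβ.ne (hα'.trans hβ'.symm)
  · have hlt : α ^ (k + 1) < β ^ (k + 1) := pow_lt_pow_left₀ hαβ hα.le (by omega)
    set u := α ^ (k + 1)
    set w := β ^ (k + 1)
    have hu : 0 < u := by positivity
    -- Cramer's rule for `V (k + 1)` in the basis `A`, `B`.
    refine ⟨A, V (k + 1), B, rfl, rfl, rfl, (u * a * d - w * b * c) / (a * d - b * c),
      a * b * (w - u) / (a * d - b * c), ?_, ?_, ?_⟩
    · have : (u * a * d - w * b * c) / (a * d - b * c) =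
          u + (u - w) * (b * c * (a * d - b * c)) / (a * d - b * c) ^ 2 := by
        field_simp
        ring
      rw [this]
      have : 0 ≤ (u - w) * (b * c * (a * d - b * c)) / (a * d - b * c) ^ 2 :=
        div_nonneg (mul_nonneg_of_nonpos_of_nonpos (by linarith) h2) (sq_nonneg _)
      linarith
    · have : a * b * (w - u) / (a * d - b * c) =
          (w - u) * (a * b * (a * d - b * c)) / (a * d - b * c) ^ 2 := by
        field_simp
      rw [this]
      have : 0 < w - u := by linarith
      positivity
    · rw [hV, hA, hB, smul_add, smul_add, smul_smul, smul_smul, smul_smul, smul_smul,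
        add_add_add_comm, ← add_smul, ← add_smul]
      congr 2 <;> field_simp <;> ring
  · have hlt : α ^ (k + 2) < β ^ (k + 2) := pow_lt_pow_left₀ hαβ hα.le (by omega)
    have hlt' : α ^ (k + 1) < β ^ (k + 1) := pow_lt_pow_left₀ hαβ hα.le (by omega)
    have hd : 0 < β ^ (k + 2) - α ^ (k + 2) := by linarith
    have hd' : 0 < β ^ (k + 1) - α ^ (k + 1) := by linarith
    have hd'' : 0 < β - α := by linarith
    refine ⟨A, V (k + 1), V (k + 2), rfl, rfl, rfl,
      α ^ (k + 1) * β ^ (k + 1) * (β - α) / (β ^ (k + 2) - α ^ (k + 2)),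
      (β ^ (k + 1) - α ^ (k + 1)) / (β ^ (k + 2) - α ^ (k + 2)), by positivity, by positivity, ?_⟩
    rw [hV, hV, hA, smul_add, smul_add, smul_smul, smul_smul, smul_smul, smul_smul,
      add_add_add_comm, ← add_smul, ← add_smul]
    congr 2 <;> field_simp <;> ring

/-- If `bM₂` has a negative `A`-coordinate, it lies between `B` and `-A`. The pair `(B, -A)` is then
in the domain as well, and the orbit of `B` stays between its members. -/
theorem not_mem_of_scaling_of_pos {M₁ M₂ : Mat n}
    (hM : ∀ x y : ℝ, x • M₁ + y • M₂ = 0 → x = 0 ∧ y = 0) (hs : HasScaling M₂ M₁)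
    {A B : NormalVector n} {a b c d : ℝ} (hA : A.mat = a • M₁ + b • M₂)
    (hB : B.mat = c • M₁ + d • M₂) (h1 : 0 < a * b * (a * d - b * c)) :
    (A.perp, B.perp) ∉ D := by
  rcases le_or_gt (b * c * (a * d - b * c)) 0 with h2 | h2
  · exact H.not_mem_of_scaling hM hs hA hB h1 h2
  · intro hD
    have hD' : (B.perp, A.neg.perp) ∈ D := H.swap_mem _ _ (H.neg_mem _ _ hD)
    have hA' : A.neg.mat = (-a) • M₁ + (-b) • M₂ := by
      change -A.mat = _
      rw [hA, neg_smul, neg_smul, neg_add]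
    have had : 0 < a * d * (a * d - b * c) := by nlinarith [sq_nonneg (a * d - b * c)]
    refine H.not_mem_of_scaling hM hs hB hA' ?_ ?_ hD'
    · have h3 : 0 < (a * b) ^ 2 * (c * d * (c * -b - d * -a)) * (a * d - b * c) ^ 2 := by
        have := mul_pos (mul_pos h1 h2) had
        calc _ < _ := this
          _ = _ := by ring
      by_contra! h4
      have : (a * b) ^ 2 * (c * d * (c * -b - d * -a)) * (a * d - b * c) ^ 2 ≤ 0 :=
        mul_nonpos_of_nonpos_of_nonneg (mul_nonpos_of_nonneg_of_nonpos (sq_nonneg _) h4)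
          (sq_nonneg _)
      linarith
    · calc d * -a * (c * -b - d * -a) = -(a * d * (a * d - b * c)) := by ring
        _ ≤ 0 := by linarith

/-- Exchanging `M₁` and `M₂` keeps `ab` and reverses the sign of `ad - bc`, so one of the two
scalings pushes in the required direction. -/
theorem not_mem_of_mul_ne_zero {M₁ M₂ : Mat n}
    (hM : ∀ x y : ℝ, x • M₁ + y • M₂ = 0 → x = 0 ∧ y = 0) (hs : HasScaling M₁ M₂)
    (hs' : HasScaling M₂ M₁) {A B : NormalVector n} {a b c d : ℝ}
    (hA : A.mat = a • M₁ + b • M₂) (hB : B.mat = c • M₁ + d • M₂) (hab : a * b ≠ 0)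
    (hΔ : a * d - b * c ≠ 0) : (A.perp, B.perp) ∉ D := by
  rcases lt_or_gt_of_ne (mul_ne_zero hab hΔ) with h | h
  · refine H.not_mem_of_scaling_of_pos (M₁ := M₂) (M₂ := M₁) (a := b) (b := a) (c := d) (d := c)
      (fun x y h => ?_) hs (by rw [hA, add_comm]) (by rw [hB, add_comm]) ?_
    · rw [add_comm] at h
      exact (hM y x h).symm
    · calc 0 < -(a * b * (a * d - b * c)) := by linarith
        _ = _ := by ring
  · exact H.not_mem_of_scaling_of_pos hM hs' hA hB h

/-- If `A` and `B` both lie on the lines of `M₁` and `M₂`, scaling fixes their hyperplanes. The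
domain then also contains the pair of `A` and a nearby `A + εB`, which lies on neither line. -/
theorem not_mem_of_det_ne_zero (hn : n ≠ 0) {M₁ M₂ : Mat n}
    (hM : ∀ x y : ℝ, x • M₁ + y • M₂ = 0 → x = 0 ∧ y = 0) (hs : HasScaling M₁ M₂)
    (hs' : HasScaling M₂ M₁) {A B : NormalVector n} {a b c d : ℝ}
    (hA : A.mat = a • M₁ + b • M₂) (hB : B.mat = c • M₁ + d • M₂)
    (hΔ : a * d - b * c ≠ 0) : (A.perp, B.perp) ∉ D := by
  intro hD
  by_cases hab : a * b = 0
  swap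
  · exact H.not_mem_of_mul_ne_zero hM hs hs' hA hB hab hΔ hD
  by_cases hcd : c * d = 0
  swap
  · exact H.not_mem_of_mul_ne_zero hM hs hs' hB hA hcd (by intro h; apply hΔ; linarith)
      (H.swap_mem _ _ hD)
  have hAB : ∀ x y : ℝ, x • A.mat + y • B.mat = 0 → x = 0 ∧ y = 0 := by
    intro x y h
    rw [hA, hB, smul_add, smul_add, smul_smul, smul_smul, smul_smul, smul_smul,
      add_add_add_comm, ← add_smul, ← add_smul] at h
    obtain ⟨e1, e2⟩ := hM _ _ h
    constructor
    · apply mul_right_cancel₀ hΔ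
      linear_combination d * e1 - c * e2
    · apply mul_right_cancel₀ hΔ
      linear_combination a * e2 - b * e1
  obtain ⟨ε, C, hε, hC⟩ := exists_normalVector_add_smul hn A B hAB
  have hAC : (A.perp, C.perp) ∈ D :=
    (H.between_mem _ _ _ hD ⟨A, C, B, rfl, rfl, rfl, 1, ε, one_pos, hε, by rw [hC, one_smul]⟩).1
  have hC' : C.mat = (a + ε * c) • M₁ + (b + ε * d) • M₂ := by
    rw [hC, hA, hB, smul_add, smul_smul, smul_smul, add_add_add_comm, ← add_smul, ← add_smul]
  refine H.not_mem_of_mul_ne_zero hM hs hs' hC' hA ?_ ?_ (H.swap_mem _ _ hAC)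
  · have e : (a + ε * c) * (b + ε * d) = ε * (a * d + b * c) := by
      linear_combination hab + ε ^ 2 * hcd
    rw [e]
    refine mul_ne_zero hε.ne' fun h0 => ?_
    have : (a * d - b * c) ^ 2 = 0 := by
      linear_combination (a * d + b * c) * h0 - 4 * c * d * hab
    exact hΔ (pow_eq_zero_iff (two_ne_zero) |>.mp this)
  · intro h0
    have : ε * (a * d - b * c) = 0 := by linear_combination -h0
    exact mul_ne_zero hε.ne' hΔ this

end IsInvariantAngleFunction

theorem NormalVector.linearIndependent_of_perp_ne {n : ℕ} {A B : NormalVector n}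
    (h : A.perp ≠ B.perp) (h' : A.perp ≠ B.perp.neg) (x y : ℝ)
    (hxy : x • A.mat + y • B.mat = 0) : x = 0 ∧ y = 0 := by
  by_cases hx : x = 0
  · subst hx
    rw [zero_smul, zero_add, smul_eq_zero] at hxy
    exact ⟨rfl, hxy.resolve_right B.ne_zero⟩
  exfalso
  have e : A.mat = (-(y / x)) • B.mat := by
    have := congrArg (fun M => x⁻¹ • M) hxy
    simp only [smul_add, smul_smul, inv_mul_cancel₀ hx, one_smul, smul_zero] at this
    rw [eq_neg_of_add_eq_zero_left this, neg_smul, div_eq_inv_mul]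
  rcases lt_trichotomy (-(y / x)) 0 with hc | hc | hc
  · apply h'
    refine (NormalVector.perp_eq_of_smul (A := B.neg) (B := A) (c := y / x) (by linarith) ?_).symm
    change A.mat = (y / x) • -B.mat
    rw [e, neg_smul, smul_neg]
  · rw [hc, zero_smul] at e
    exact A.ne_zero e
  · exact h (NormalVector.perp_eq_of_smul hc e).symm

theorem exists_homCoord_of_pencilForm_eq_zero {n : ℕ} {A B : Mat n} (h : nonrealRoots A B = ∅)
    {x y : ℂ} (hxy : pencilForm A B y (-x) = 0) : (x = 0 ∧ y = 0) ∨
      ∃ w ∈ realSpectrum A B, ∃ k : ℂ, x = k * (homCoord w).1 ∧ y = k * (homCoord w).2 := by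
  by_cases hy : y = 0
  · subst hy
    by_cases hx : x = 0
    · exact Or.inl ⟨hx, rfl⟩
    refine Or.inr ⟨OnePoint.infty, ?_, x, by simp, by simp⟩
    have := pencilForm_smul A B x⁻¹ 0 (-x)
    rw [hxy, mul_zero, mul_zero, mul_neg, inv_mul_cancel₀ hx] at this
    simpa [realSpectrum] using this
  · rw [pencilForm_eq_zero_iff A B hy, neg_neg] at hxy
    have him : (x / y).im = 0 := by
      by_contra him
      exact Set.eq_empty_iff_forall_notMem.mp h _ ⟨him, hxy⟩
    have hre : ((x / y).re : ℂ) = x / y := Complex.ext rfl (by simpa using him.symm)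
    refine Or.inr ⟨((x / y).re : ℝ), ?_, y, ?_, by simp⟩
    · rw [coe_mem_realSpectrum, hre]
      exact hxy
    · rw [homCoord_coe, hre]
      field_simp

/-- Pads the spectrum to two points, so that `M₁` and `M₂` are available even when there are fewer
eigenvalues. -/
theorem exists_subset_pair {α : Type*} [Nontrivial α] {s : Set α} (h : s.encard ≤ 2) :
    ∃ a b, a ≠ b ∧ s ⊆ {a, b} := by
  rcases s.eq_empty_or_nonempty with rfl | ⟨a, ha⟩
  · obtain ⟨a, b, hab⟩ := exists_pair_ne α
    exact ⟨a, b, hab, Set.empty_subset _⟩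
  have h1 : (s \ {a}).encard ≤ 1 := by
    rw [← Set.encard_sdiff_singleton_add_one ha] at h
    exact (WithTop.add_le_add_iff_right ENat.one_ne_top).mp (h.trans_eq one_add_one_eq_two.symm)
  have hs : ∀ b, s \ {a} ⊆ {b} → s ⊆ {a, b} := by
    intro b hb x hx
    by_cases hxa : x = a
    · exact Or.inl hxa
    · exact Or.inr (hb ⟨hx, hxa⟩)
  rcases Set.encard_le_one_iff_eq.mp h1 with h0 | ⟨b, hb⟩
  · obtain ⟨b, hb⟩ := exists_ne a
    exact ⟨a, b, hb.symm, hs b (by rw [h0]; exact Set.empty_subset _)⟩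
  · have : b ∈ s \ {a} := by rw [hb]; rfl
    exact ⟨a, b, fun e => this.2 e.symm, hs b hb.subset⟩

/-- Take for `M₁` and `M₂` the members belonging to two points that contain the spectrum. Every zero
of the determinant form, real or complex, then lies on one of their two lines, which is what the
scalings need. -/
theorem not_mem_of_isTypeThree {n : ℕ} {A B : NormalVector n} (hT : IsTypeThree A.mat B.mat)
    (h : A.perp ≠ B.perp) (h' : A.perp ≠ B.perp.neg)
    {D : Set (CoHyperplane n × CoHyperplane n)} {θ : CoHyperplane n → CoHyperplane n → ℝ}
    (H : IsInvariantAngleFunction D θ) : (A.perp, B.perp) ∉ D := by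
  have hn : n ≠ 0 := by
    rintro rfl
    exact A.ne_zero (Subsingleton.elim _ _)
  obtain ⟨-, hreal, hcard⟩ := hT
  have hnonreal : nonrealRoots A.mat B.mat = ∅ := by
    rw [genEigenvalues_subset_extendedReals_iff] at hreal
    exact Set.eq_empty_iff_forall_notMem.mpr fun z hz => hz.1 (hreal z hz.2)
  rw [genEigenvalues_eq_image hreal, extendedOfReal_injective.encard_image] at hcard
  obtain ⟨w₁, w₂, hw, hsub⟩ := exists_subset_pair hcard
  have hW := wedge_homCoord_ne_zero hw
  have hind := NormalVector.linearIndependent_of_perp_ne h h'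
  generalize hp₁ : homCoord w₁ = p₁ at hW
  generalize hp₂ : homCoord w₂ = p₂ at hW
  obtain ⟨x₁, y₁⟩ := p₁
  obtain ⟨x₂, y₂⟩ := p₂
  simp only [wedge] at hW
  let M₁ : Mat n := y₁ • A.mat + (-x₁) • B.mat
  let M₂ : Mat n := y₂ • A.mat + (-x₂) • B.mat
  have hpencil : ∀ x y : ℂ, pencilForm M₁ M₂ x y = 0 → x = 0 ∨ y = 0 := by
    intro x y hxy
    have hWc : (y₁ * x₂ - x₁ * y₂ : ℂ) ≠ 0 := by exact_mod_cast hW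
    rw [pencilForm_comb] at hxy
    have e : (x * ((-x₁ : ℝ) : ℂ) + y * ((-x₂ : ℝ) : ℂ)) = -(x * x₁ + y * x₂) := by
      push_cast; ring
    rw [e] at hxy
    rcases exists_homCoord_of_pencilForm_eq_zero hnonreal hxy with ⟨e1, e2⟩ | ⟨w, hwS, k, e1, e2⟩
    · left
      apply mul_right_cancel₀ hWc
      linear_combination x₂ * e2 - y₂ * e1
    · rcases hsub hwS with rfl | rfl
      · right
        rw [hp₁] at e1 e2
        apply mul_right_cancel₀ hWc
        linear_combination y₁ * e1 - x₁ * e2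
      · left
        rw [hp₂] at e1 e2
        apply mul_right_cancel₀ hWc
        linear_combination x₂ * e2 - y₂ * e1
  have hsymm₁ : M₁.IsSymm := (A.symm.smul y₁).add (B.symm.smul (-x₁))
  have hsymm₂ : M₂.IsSymm := (A.symm.smul y₂).add (B.symm.smul (-x₂))
  have hs : HasScaling M₁ M₂ := exists_specialLinear_scaling hn hsymm₁ hsymm₂ hpencil
  have hs' : HasScaling M₂ M₁ := exists_specialLinear_scaling hn hsymm₂ hsymm₁ fun x y hxy => by
    rw [pencilForm, add_comm] at hxy
    exact (hpencil y x hxy).symm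
  have hM : ∀ x y : ℝ, x • M₁ + y • M₂ = 0 → x = 0 ∧ y = 0 := by
    intro x y hxy
    have e : x • M₁ + y • M₂ = (x * y₁ + y * y₂) • A.mat + (-(x * x₁ + y * x₂)) • B.mat := by
      simp only [M₁, M₂]
      module
    rw [e] at hxy
    obtain ⟨e1, e2⟩ := hind _ _ hxy
    constructor
    · apply mul_right_cancel₀ hW
      linear_combination x₂ * e1 + y₂ * e2
    · apply mul_right_cancel₀ hW
      linear_combination -y₁ * e2 - x₁ * e1
  set W := y₁ * x₂ - x₁ * y₂ with hWdef
  -- Inverts the base change from `A`, `B` to `M₁`, `M₂`, whose determinant is nonzero as the two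
  -- points are distinct.
  have hA : A.mat = (x₂ / W) • M₁ + (-(x₁ / W)) • M₂ := by
    have : (x₂ / W) • M₁ + (-(x₁ / W)) • M₂ =
        (W / W) • A.mat + ((x₁ * x₂ - x₁ * x₂) / W) • B.mat := by
      simp only [M₁, M₂]
      rw [hWdef]
      module
    rw [this, div_self hW, sub_self, zero_div, one_smul, zero_smul, add_zero]
  have hB : B.mat = (y₂ / W) • M₁ + (-(y₁ / W)) • M₂ := by
    have : (y₂ / W) • M₁ + (-(y₁ / W)) • M₂ =
        ((y₁ * y₂ - y₁ * y₂) / W) • A.mat + (W / W) • B.mat := by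
      simp only [M₁, M₂]
      rw [hWdef]
      module
    rw [this, div_self hW, sub_self, zero_div, one_smul, zero_smul, zero_add]
  refine H.not_mem_of_det_ne_zero hn hM hs hs' hA hB ?_
  have : x₂ / W * -(y₁ / W) - -(x₁ / W) * (y₂ / W) = -(W / W ^ 2) := by
    field_simp
    rw [hWdef]
    ring
  rw [this]
  exact neg_ne_zero.mpr (div_ne_zero hW (pow_ne_zero 2 hW))

end SelbergSpace

theorem mainTheorem1 (n : ℕ) :
    -- nonreal generalized eigenvalues
    (∃ θ : CoHyperplane n → CoHyperplane n → ℝ,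
      IsInvariantAngleFunction (pairsWith IsTypeOne) θ ∧
      ∀ A B : NormalVector n, IsTypeOne A.mat B.mat →
        ∀ (k : ℕ) (l : Fin k → ℂ), ListsNonreal A.mat B.mat l →
          θ A.perp B.perp = (1 / (k : ℝ)) * ∑ i, |Complex.arg (l i)|) ∧
    -- at least three distinct generalized eigenvalues, all real or infinite
    ((∀ (k : ℕ) (l : Fin k → ℝ), 3 ≤ k → StrictMono l → 0 < radicand l ∧ |cosQuotient l| ≤ 1) ∧
      ∃ θ : CoHyperplane n → CoHyperplane n → ℝ,
        IsInvariantAngleFunction (pairsWith IsTypeTwo) θ ∧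
        ∀ A B : NormalVector n, IsTypeTwo A.mat B.mat →
          (∀ (k : ℕ) (l : Fin k → ℝ), StrictMono l →
            genEigenvalues A.mat B.mat = Set.range (fun i => realPoint (l i)) →
            θ A.perp B.perp = Real.arccos (cosQuotient l)) ∧
          (∀ (k : ℕ) (l : Fin k → ℝ), StrictMono l →
            genEigenvalues A.mat B.mat =
              insert OnePoint.infty (Set.range (fun i => realPoint (l i))) →
            Filter.Tendsto
              (fun x : ℝ => Real.arccos (cosQuotient (Fin.snoc l x : Fin (k + 1) → ℝ)))
              Filter.atTop (nhds (θ A.perp B.perp)))) ∧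
    -- at most two distinct generalized eigenvalues, all real or infinite
    (∀ A B : NormalVector n, IsTypeThree A.mat B.mat →
      A.perp ≠ B.perp → A.perp ≠ B.perp.neg →
      ∀ (D : Set (CoHyperplane n × CoHyperplane n)) (θ : CoHyperplane n → CoHyperplane n → ℝ),
        IsInvariantAngleFunction D θ → (A.perp, B.perp) ∉ D) := by
  refine ⟨⟨hyperplaneAngle meanArg, (isMatrixAngle_meanArg n).isInvariantAngleFunction, ?_⟩,
    ⟨fun k l hk hl => radicand_pos_and_abs_cosQuotient_le_one hk hl,
      hyperplaneAngle polygonAngle, (isMatrixAngle_polygonAngle n).isInvariantAngleFunction, ?_⟩,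
    fun A B hT h h' D θ H => not_mem_of_isTypeThree hT h h' H⟩
  · intro A B hT k l hl
    rw [(isMatrixAngle_meanArg n).hyperplaneAngle_perp hT, meanArg_eq_of_listsNonreal hl]
  · intro A B hT
    rw [(isMatrixAngle_polygonAngle n).hyperplaneAngle_perp hT]
    exact ⟨fun k l hl hE => hT.polygonAngle_eq_arccos hl hE,
      fun k l hl hE => hT.tendsto_arccos hl hE⟩
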